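/- Let $T$ be a complete first-order theory and let $\mathfrak C$ be a monster model of $T$ ($\bar\kappa$-saturated for a large cardinal $\bar\kappa$). Types are computed in $\mathfrak C$: $\mathrm{tp}(\bar c,A)$ is the set of formulas $\varphi(\bar x,\bar a)$, $\bar a$ from $A$, satisfied by $\bar c$; sequences may be infinite, $\bar c\trianglelefteq\bar c'$ means that $\bar c$ is an initial segment of $\bar c'$, and in a set of parameters a sequence stands for its range and $+$ for union. A type $p(\bar x)$ does not split over $A$ if there are no $\varphi(\bar x,\bar b),\neg\varphi(\bar x,\bar c)\in p$ with $\mathrm{tp}(\bar b,A)=\mathrm{tp}(\bar c,A)$; $p\vdash q$ means that every formula of $q$ follows, in $\mathfrak C$, from finitely many formulas of $p$. Let $\kappa,\theta$ be cardinals, $J$ an infinite linear order and $B\subseteq M\subseteq\mathfrak C$. We say that $\langle(\bar c_t,\bar d_t):t\in J\rangle$ is a strict $(\kappa,<\theta)$-decomposition over $(M,B)$ if: (a) $|B|<\kappa$ and $M\prec\mathfrak C$ is $\kappa$-saturated (if $\kappa=0$, then instead $M$ is any set containing $B$, and $|B|$ is not restricted); (b) the length $\alpha$ of $\bar c_t$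 and the length $\beta$ of $\bar d_t$ do not depend on $t$, and $\alpha,\beta<\theta$; (c) if $t_0<\dots<t_k$ in $J$, then $\mathrm{tp}(\bar c_{t_n},M+\bar c_{t_0}{}^\frown\bar d_{t_0}+\dots+\bar c_{t_{n-1}}{}^\frown\bar d_{t_{n-1}})$, $n\le k$, increases with $n$ and does not split over $B$; (d) $\langle\bar c_t{}^\frown\bar d_t:t\in J\rangle$ is an indiscernible sequence over $M$; (e) if $s<t$ in $J$, then $\mathrm{tp}(\bar d_t,\bar c_t+\bar d_s)\vdash\mathrm{tp}\big(\bar d_t,\bigcup\{\bar c_r{}^\frown\bar d_r:r\le s\}\cup\bigcup\{\bar c_r:r\in J\}\cup M\big)$; (f) for every $A\subseteq M$ with $|A|<\kappa$ there are $\bar c\in{}^{\alpha}M$, $\bar d\in{}^{\beta}M$ such that $\langle\bar c{}^\frown\bar d\rangle{}^\frown\langle\bar c_t{}^\frown\bar d_t:t\in J\rangle$ is an indiscernible sequence over $A$. **Claim.** Let $\theta$ be a regular cardinal, let $\kappa$ be a cardinal with $\mathrm{cf}(\kappa)\ge\theta$ (for example, $\kappa\ge\theta$ regular) or $\kappa=0$,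 let $\delta<\theta$ be a limit ordinal, and let $M\subseteq\mathfrak C$ with $|M|<\bar\kappa$. For each $\alpha<\delta$ let $\langle(\bar c^\alpha_n,\bar d^\alpha_n):n<\omega\rangle$ be a strict $(\kappa,<\theta)$-decomposition over $(M,B_\alpha)$. Assume that $\bar c^\alpha_n\trianglelefteq\bar c^\beta_n$, $\bar d^\alpha_n\trianglelefteq\bar d^\beta_n$ and $B_\alpha\subseteq B_\beta$ whenever $\alpha<\beta<\delta$ and $n<\omega$. Put $\bar c^\delta_n=\bigcup_{\alpha<\delta}\bar c^\alpha_n$, $\bar d^\delta_n=\bigcup_{\alpha<\delta}\bar d^\alpha_n$ and $B_\delta=\bigcup_{\alpha<\delta}B_\alpha$. Then $\langle(\bar c^\delta_n,\bar d^\delta_n):n<\omega\rangle$ is a strict $(\kappa,<\theta)$-decomposition over $(M,B_\delta)$. -/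

import Mathlib

open Set Cardinal

universe u v w x y

/-! ## Transfinite sequences

A sequence of length `α` of elements of `X` is a function `Set.Iio α → X`. -/

/-- `s ⊴ t`: the sequence `s` is an initial segment of the sequence `t`. -/
def IsInitialSegment {X : Type x} {α β : Ordinal.{u}}
    (s : Set.Iio α → X) (t : Set.Iio β → X) : Prop :=
  ∃ h : α ≤ β, ∀ i : Set.Iio α, t ⟨i.1, lt_of_lt_of_le i.2 h⟩ = s i

theorem exists_lt_of_mem_Iio_iSup {I : Type y} [Small.{u} I] {len : I → Ordinal.{u}}
    (i : Set.Iio (⨆ a, len a)) : ∃ a, i.1 < len a :=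
  (Ordinal.lt_iSup_iff).1 i.2

/-- The union `⋃ₐ sₐ` of a family of sequences, of length `supₐ ℓg(sₐ)`; it is meant for families
that are increasing under `⊴`, where the value at `i` is `sₐ(i)` for every `a` with
`i < ℓg(sₐ)` (see `isInitialSegment_seqUnion`). -/
noncomputable def seqUnion {X : Type x} {I : Type y} [Small.{u} I] {len : I → Ordinal.{u}}
    (s : ∀ a, Set.Iio (len a) → X) : Set.Iio (⨆ a, len a) → X := fun i =>
  s (Classical.choose (exists_lt_of_mem_Iio_iSup i))
    ⟨i.1, Classical.choose_spec (exists_lt_of_mem_Iio_iSup i)⟩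

theorem isInitialSegment_seqUnion {X : Type x} {I : Type y} [LinearOrder I] [Small.{u} I]
    {len : I → Ordinal.{u}} (s : ∀ a, Set.Iio (len a) → X)
    (hs : ∀ a b, a < b → IsInitialSegment (s a) (s b)) (a : I) :
    IsInitialSegment (s a) (seqUnion s) := by
  refine ⟨Ordinal.le_iSup len a, fun i => ?_⟩
  have hb := Classical.choose_spec (exists_lt_of_mem_Iio_iSup (len := len)
    ⟨i.1, lt_of_lt_of_le i.2 (Ordinal.le_iSup len a)⟩)
  change s _ ⟨i.1, hb⟩ = s a i
  generalize Classical.choose (exists_lt_of_mem_Iio_iSup (len := len)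
    ⟨i.1, lt_of_lt_of_le i.2 (Ordinal.le_iSup len a)⟩) = b at hb
  rcases lt_trichotomy a b with h | h | h
  · exact (hs a b h).2 i
  · subst h; rfl
  · exact ((hs b a h).2 ⟨i.1, hb⟩).symm

namespace ModelTheory

section Types

variable (L : FirstOrder.Language.{v, w}) {C : Type u} [L.Structure C]

/-- `tp(c, A)`, computed in `C`: the set of formulas `φ(x, a)` with parameters `a` from `A` that
`c` satisfies. A formula with parameters is a formula in the variables `x` (indexed by `ι`) and in
names for the elements of `C`; the parameters are in `A` when only names of elements of `A` are
used. -/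
def tp {ι : Type x} (c : ι → C) (A : Set C) : Set (L.Formula (ι ⊕ C)) :=
  {φ | (∃ ψ : L.Formula (ι ⊕ A), φ = ψ.relabel (Sum.map id Subtype.val)) ∧
    φ.Realize (Sum.elim c id)}

variable {L}

/-- `p` does not split over `A`: there are no `φ(x, b), ¬φ(x, c) ∈ p` with
`tp(b, A) = tp(c, A)`. -/
def DoesNotSplit {ι : Type x} (p : Set (L.Formula (ι ⊕ C))) (A : Set C) : Prop :=
  ∀ (n : ℕ) (φ : L.Formula (ι ⊕ Fin n)) (b c : Fin n → C),
    φ.relabel (Sum.map id b) ∈ p → φ.not.relabel (Sum.map id c) ∈ p → tp L b A ≠ tp L c A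

/-- `p ⊢ q` (modulo the elementary diagram of `C`): every formula of `q` follows in `C` from
finitely many formulas of `p`. -/
def Entails {ι : Type x} (p q : Set (L.Formula (ι ⊕ C))) : Prop :=
  ∀ φ ∈ q, ∃ p₀ : Finset (L.Formula (ι ⊕ C)), ↑p₀ ⊆ p ∧
    ∀ z : ι → C, (∀ ψ ∈ p₀, ψ.Realize (Sum.elim z id)) → φ.Realize (Sum.elim z id)

variable (L)

/-- The sequence `⟨a_t : t ∈ J⟩` is indiscernible over `A`: for `s₀ < ⋯ < sₙ₋₁` and
`t₀ < ⋯ < tₙ₋₁` the concatenations of the `a_{sᵢ}` and of the `a_{tᵢ}` have the same type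
over `A`. -/
def Indiscernible {J : Type y} [LinearOrder J] {ι : Type x} (a : J → ι → C) (A : Set C) : Prop :=
  ∀ (n : ℕ) (s t : Fin n → J), StrictMono s → StrictMono t →
    tp L (fun k : Fin n × ι => a (s k.1) k.2) A = tp L (fun k : Fin n × ι => a (t k.1) k.2) A

variable (C)

/-- `C` is `κ`-saturated: every set of formulas in one variable over fewer than `κ` parameters
that is finitely satisfiable in `C` is realized in `C`. -/
def IsSaturated (κ : Cardinal.{u}) : Prop :=
  ∀ A : Set C, #A < κ → ∀ p : Set (L.Formula (Unit ⊕ A)),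
    (∀ p₀ : Finset (L.Formula (Unit ⊕ A)), ↑p₀ ⊆ p →
      ∃ z : C, ∀ φ ∈ p₀, φ.Realize (Sum.elim (fun _ => z) Subtype.val)) →
    ∃ z : C, ∀ φ ∈ p, φ.Realize (Sum.elim (fun _ => z) Subtype.val)

end Types

/-- `⟨(c_t, d_t) : t ∈ J⟩` is a strict `(κ, <θ)`-decomposition over `(M, B)`. The concatenation of
`c_t` and `d_t` is `Sum.elim (c t) (d t)`. For `κ = 0` the set `M` need not be a model. -/
structure IsStrictDecomposition (L : FirstOrder.Language.{v, w}) {C : Type u} [L.Structure C]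
    (κ θ : Cardinal.{u}) (M B : Set C) {J : Type y} [LinearOrder J] [Infinite J]
    {α β : Ordinal.{u}} (c : J → Set.Iio α → C) (d : J → Set.Iio β → C) : Prop where
  base_subset : B ⊆ M
  card_base_lt : κ ≠ 0 → #B < κ
  saturated : κ ≠ 0 → ∃ N : L.ElementarySubstructure C, (N : Set C) = M ∧ IsSaturated L N κ
  length_fst_lt : α < θ.ord
  length_snd_lt : β < θ.ord
  increasing : ∀ (k : ℕ) (t : Fin (k + 1) → J), StrictMono t → ∀ m n : Fin (k + 1), m ≤ n →
    tp L (c (t m)) (M ∪ ⋃ j < m, (range (c (t j)) ∪ range (d (t j)))) ⊆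
      tp L (c (t n)) (M ∪ ⋃ j < n, (range (c (t j)) ∪ range (d (t j))))
  doesNotSplit : ∀ (k : ℕ) (t : Fin (k + 1) → J), StrictMono t → ∀ n : Fin (k + 1),
    DoesNotSplit (tp L (c (t n)) (M ∪ ⋃ j < n, (range (c (t j)) ∪ range (d (t j))))) B
  indiscernible : Indiscernible L (fun t => Sum.elim (c t) (d t)) M
  entails : ∀ s t : J, s < t →
    Entails (tp L (d t) (range (c t) ∪ range (d s)))
      (tp L (d t) ((⋃ r ≤ s, (range (c r) ∪ range (d r))) ∪ (⋃ r, range (c r)) ∪ M))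
  reflects : ∀ A ⊆ M, #A < κ →
    ∃ (c' : Set.Iio α → C) (d' : Set.Iio β → C), range c' ⊆ M ∧ range d' ⊆ M ∧
      Indiscernible L (fun t : WithBot J =>
        t.recBotCoe (Sum.elim c' d') (fun s => Sum.elim (c s) (d s))) A

end ModelTheory

/-! ### Free variables, relabelling, and quantification over infinite tuples. -/

namespace FirstOrder.Language

variable {L : Language.{v, w}}

/-! All clauses except (f) pass to the union because a formula sees only finitely many coordinates
and parameters, all of which appear at one stage of the chain, and because fewer than `cf κ` sets of
size `< κ` have a union of size `< κ`. For `κ = 0` clause (f) is vacuous.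

For (f), the tuples that the stages provide need not extend one another, so a single tuple is built
by saturation. Let `A₀` be `A` together with all `B_a`. For each stage `a` choose `e_a` in `M` that
prolongs the `a`-th sequence to the left over `A₀`, and then `f_a` in `M` that prolongs it over
`A₁`, the union of `A₀` and all the `e_a`. If `a ≤ b`, then both `e_a⌢f_a` and `(e_b restricted to
a)⌢f_a` have over `A₀` the type of two consecutive members of the `a`-th sequence
(`sameTypeOver_of_prolongations`). Hence the types `tp(e_a, A₀ + f_a)` cohere, and since `M` is
`κ`-saturated, one tuple `g` in `M` has restrictions realizing all of them
(`IsSaturated.exists_sameTypeOver`).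

It remains to see that each restriction of `g` still prolongs the `a`-th sequence. This is
`sameTypeOver_of_reflects`: for tuples of `M`, having the type of `e_a` over `A₀ + f_a` already
forces having its type over `A₀` and the whole `a`-th sequence. The members are adjoined one at a
time: `c_k` by non-splitting over `B_a ⊆ A₀`, and `d_k` by clause (e), with `f_a` playing the part
of a member preceding the first one. -/

theorem Term.mem_varFinsetLeft_relabel {α α' β β' : Type*} [DecidableEq α] [DecidableEq α']
    (t : L.Term (α ⊕ β)) (f : α → α') (g : β → β') {a : α} (ha : a ∈ t.varFinsetLeft) :
    f a ∈ (t.relabel (Sum.map f g)).varFinsetLeft := by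
  induction t with
  | var i =>
    cases i with
    | inl i => simp_all [Term.varFinsetLeft, Term.relabel]
    | inr i => simp_all [Term.varFinsetLeft]
  | func F ts ih =>
    simp only [Term.varFinsetLeft, Term.relabel, Finset.mem_biUnion, Finset.mem_univ,
      true_and] at ha ⊢
    exact ha.imp fun i hi => ih i hi

theorem Term.exists_of_mem_varFinsetLeft_relabel {α α' β β' : Type*} [DecidableEq α]
    [DecidableEq α'] (t : L.Term (α ⊕ β)) (f : α → α') (g : β → β') {a : α'}
    (ha : a ∈ (t.relabel (Sum.map f g)).varFinsetLeft) : ∃ i ∈ t.varFinsetLeft, f i = a := by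
  induction t with
  | var i =>
    cases i with
    | inl i => simp_all [Term.varFinsetLeft, Term.relabel]
    | inr i => simp_all [Term.varFinsetLeft, Term.relabel]
  | func F ts ih =>
    simp only [Term.varFinsetLeft, Term.relabel, Finset.mem_biUnion, Finset.mem_univ,
      true_and] at ha ⊢
    obtain ⟨i, hi⟩ := ha
    obtain ⟨j, hj, rfl⟩ := ih i hi
    exact ⟨j, ⟨i, hj⟩, rfl⟩

theorem Term.varFinsetLeft_relabel {α α' β β' : Type*} [DecidableEq α] [DecidableEq α']
    (t : L.Term (α ⊕ β)) (f : α → α') (g : β → β') :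
    (t.relabel (Sum.map f g)).varFinsetLeft = t.varFinsetLeft.image f := by
  ext a
  rw [Finset.mem_image]
  refine ⟨t.exists_of_mem_varFinsetLeft_relabel f g, ?_⟩
  rintro ⟨i, hi, rfl⟩
  exact t.mem_varFinsetLeft_relabel f g hi

theorem BoundedFormula.relabelAux_sumInl_comp {α α' : Type*} (f : α → α') {m : ℕ} (k : ℕ) :
    relabelAux (Sum.inl ∘ f : α → α' ⊕ Fin m) k = Sum.map f (Fin.natAdd m) := by
  ext i
  cases i <;> simp [relabelAux]

theorem BoundedFormula.freeVarFinset_relabel {α α' : Type*} [DecidableEq α] [DecidableEq α']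
    (f : α → α') {m n : ℕ} (φ : L.BoundedFormula α n) :
    (φ.relabel (Sum.inl ∘ f : α → α' ⊕ Fin m)).freeVarFinset = φ.freeVarFinset.image f := by
  induction φ with
  | falsum => rfl
  | equal t₁ t₂ =>
    simp [relabel, mapTermRel, relabelAux_sumInl_comp, Term.varFinsetLeft_relabel,
      Finset.image_union]
  | rel R ts =>
    simp [relabel, mapTermRel, relabelAux_sumInl_comp, Term.varFinsetLeft_relabel,
      Finset.biUnion_image]
  | imp _ _ ih₁ ih₂ => simp [ih₁, ih₂, Finset.image_union]
  | all _ ih => simp [ih]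

theorem Formula.freeVarFinset_relabel {α α' : Type*} [DecidableEq α] [DecidableEq α']
    (f : α → α') (φ : L.Formula α) :
    BoundedFormula.freeVarFinset (φ.relabel f) =
      (BoundedFormula.freeVarFinset φ).image f :=
  BoundedFormula.freeVarFinset_relabel f φ

/-- Membership in `tp` is a syntactic equation between formulas, so equivalence of the two
relabellings would not be enough. The cast reconciles the bounds `0 + (0 + n)` and `0 + n`. -/
theorem BoundedFormula.relabel_relabel {α α' α'' : Type*} (f : α → α') (g : α' → α'') {n : ℕ}
    (φ : L.BoundedFormula α n) :
    (φ.relabel (Sum.inl ∘ f : α → α' ⊕ Fin 0)).relabel (Sum.inl ∘ g : α' → α'' ⊕ Fin 0) =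
      (φ.relabel (Sum.inl ∘ g ∘ f : α → α'' ⊕ Fin 0)).castLE (by omega) := by
  have hcomp : ∀ k, relabelAux (Sum.inl ∘ g : α' → α'' ⊕ Fin 0) (0 + k) ∘
      relabelAux (Sum.inl ∘ f : α → α' ⊕ Fin 0) k =
      Sum.map id (Fin.castLE (by omega)) ∘ relabelAux (Sum.inl ∘ g ∘ f : α → α'' ⊕ Fin 0) k := by
    intro k
    rw [← Function.comp_assoc, relabelAux_sumInl_comp, relabelAux_sumInl_comp,
      Function.comp_assoc, relabelAux_sumInl_comp]
    ext i
    rcases i with i | i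
    · rfl
    · simp [Fin.ext_iff]
  induction φ with
  | falsum => rfl
  | equal t₁ t₂ => simp only [relabel, mapTermRel, castLE, Term.relabel_relabel, hcomp]
  | rel R ts =>
    simp only [relabel, mapTermRel, castLE, Term.relabel_relabel, hcomp, id]
    congr 1
    funext i
    simp only [Function.comp_apply, Term.relabel_relabel]
  | imp _ _ ih₁ ih₂ => simp [ih₁, ih₂]
  | all _ ih => simp [ih]

theorem Formula.relabel_relabel {α α' α'' : Type*} (f : α → α') (g : α' → α'')
    (φ : L.Formula α) : (φ.relabel f).relabel g = φ.relabel (g ∘ f) :=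
  (BoundedFormula.relabel_relabel f g φ).trans (BoundedFormula.castLE_rfl _ _)

theorem Formula.exists_restrict {α : Type*} [DecidableEq α] (φ : L.Formula α) (s : Set α)
    (hs : ↑(BoundedFormula.freeVarFinset φ) ⊆ s) :
    ∃ χ : L.Formula s, ∀ {M : Type u} [L.Structure M] (z : α → M),
      χ.Realize (fun i => z i) ↔ φ.Realize z :=
  ⟨BoundedFormula.restrictFreeVar φ (Set.inclusion hs), fun _ =>
    BoundedFormula.realize_restrictFreeVar' hs⟩

theorem Formula.realize_congr {α : Type*} [DecidableEq α] {M : Type*} [L.Structure M]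
    (φ : L.Formula α) {y z : α → M}
    (h : ∀ i ∈ BoundedFormula.freeVarFinset φ, y i = z i) : φ.Realize y ↔ φ.Realize z := by
  obtain ⟨χ, hχ⟩ := φ.exists_restrict _ subset_rfl
  rw [← hχ, ← hχ]
  exact iff_of_eq (congrArg _ (funext fun i => h i i.2))

/-- Quantifying existentially over a tuple of variables of arbitrary length. -/
theorem Formula.exists_formula_exists {ι κ : Type*} (χ : L.Formula (ι ⊕ κ)) :
    ∃ χ' : L.Formula κ, ∀ {M : Type u} [L.Structure M] [Nonempty M] (v : κ → M),
      χ'.Realize v ↔ ∃ z : ι → M, χ.Realize (Sum.elim z v) := by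
  classical
  -- Only the finitely many quantified variables that occur are bound; the others get an arbitrary
  -- value, whence `Nonempty M`.
  let F : Finset ι := (BoundedFormula.freeVarFinset χ).toLeft
  let S : Set (ι ⊕ κ) := {i | ∀ j, i = Sum.inl j → j ∈ F}
  obtain ⟨χ₀, h₀⟩ := χ.exists_restrict S (by
    rintro i hi j rfl
    exact Finset.mem_toLeft.2 hi)
  let r : S → κ ⊕ F := fun i =>
    match i with
    | ⟨Sum.inl i, hi⟩ => Sum.inr ⟨i, hi i rfl⟩
    | ⟨Sum.inr i, _⟩ => Sum.inl i
  refine ⟨(χ₀.relabel r).iExs F, fun {M} _ _ v => ?_⟩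
  rw [Formula.realize_iExs]
  have key : ∀ z : ι → M, (χ₀.relabel r).Realize (Sum.elim v fun i : F => z i) ↔
      χ.Realize (Sum.elim z v) := by
    intro z
    rw [Formula.realize_relabel, ← h₀]
    refine iff_of_eq (congrArg _ (funext ?_))
    rintro ⟨i | i, hi⟩ <;> rfl
  constructor
  · rintro ⟨z, hz⟩
    refine ⟨fun i => if h : i ∈ F then z ⟨i, h⟩ else Classical.arbitrary M, (key _).1 ?_⟩
    simpa using hz
  · rintro ⟨z, hz⟩
    exact ⟨_, (key z).2 hz⟩

/-- A formula depends on finitely many of the variables in its second block. -/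
theorem Formula.exists_finite_right {ι κ : Type*} [DecidableEq (ι ⊕ κ)] (φ : L.Formula (ι ⊕ κ)) :
    ∃ (n : ℕ) (g : Fin n → κ) (χ : L.Formula (ι ⊕ Fin n)),
      (∀ k, Sum.inr (g k) ∈ BoundedFormula.freeVarFinset φ) ∧
      ∀ {M : Type u} [L.Structure M] (z : ι → M) (v : κ → M),
        χ.Realize (Sum.elim z fun k => v (g k)) ↔ φ.Realize (Sum.elim z v) := by
  let F : Finset κ := (BoundedFormula.freeVarFinset φ).toRight
  let S : Set (ι ⊕ κ) := {i | ∀ j, i = Sum.inr j → j ∈ F}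
  obtain ⟨χ₀, h₀⟩ := φ.exists_restrict S (by
    rintro i hi j rfl
    exact Finset.mem_toRight.2 hi)
  let e := F.equivFin
  let r : S → ι ⊕ Fin F.card := fun i =>
    match i with
    | ⟨Sum.inl i, _⟩ => Sum.inl i
    | ⟨Sum.inr i, hi⟩ => Sum.inr (e ⟨i, hi i rfl⟩)
  refine ⟨F.card, fun k => e.symm k, χ₀.relabel r,
    fun k => Finset.mem_toRight.1 (e.symm k).2, fun {M} _ z v => ?_⟩
  rw [Formula.realize_relabel, ← h₀]
  refine iff_of_eq (congrArg _ (funext ?_))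
  rintro ⟨i | i, hi⟩
  · rfl
  · simp [r]

end FirstOrder.Language

/-! ### Directed unions of index sets, and equality of types as a relation between tuples. -/

namespace ModelTheory

open FirstOrder.Language

variable (L : FirstOrder.Language.{v, w}) {C : Type u} [L.Structure C]

/-- The maps `f a` exhibit `ι` as a directed union of images of the `κ a`. -/
structure IsDirectedCover {I ι : Type*} [LinearOrder I] {κ : I → Type*} (f : ∀ a, κ a → ι) :
    Prop where
  mono : ∀ a b, a ≤ b → range (f a) ⊆ range (f b)
  cover : ∀ i, ∃ a, i ∈ range (f a)

namespace IsDirectedCover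

variable {I ι ι' : Type*} [LinearOrder I] {κ κ' : I → Type*} {f : ∀ a, κ a → ι}
  {f' : ∀ a, κ' a → ι'}

theorem exists_finset (hf : IsDirectedCover f) (S : Finset ι) (a₀ : I) :
    ∃ b, a₀ ≤ b ∧ ∀ i ∈ S, i ∈ range (f b) := by
  classical
  choose s hs using hf.cover
  have : Nonempty I := ⟨a₀⟩
  obtain ⟨b, hb⟩ := (S.image s ∪ {a₀}).exists_le
  exact ⟨b, hb a₀ (by simp), fun i hi =>
    hf.mono _ _ (hb (s i) (Finset.mem_union_left _ (Finset.mem_image_of_mem s hi))) (hs i)⟩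

theorem const [Nonempty I] : IsDirectedCover fun _ : I => (id : ι → ι) :=
  ⟨fun _ _ _ => subset_rfl, fun i => ⟨Classical.arbitrary I, i, rfl⟩⟩

theorem sumMap (hf : IsDirectedCover f) (hf' : IsDirectedCover f') :
    IsDirectedCover fun a => Sum.map (f a) (f' a) := by
  refine ⟨fun a b hab => ?_, ?_⟩
  · rintro _ ⟨i | i, rfl⟩
    · obtain ⟨j, hj⟩ := hf.mono a b hab ⟨i, rfl⟩
      exact ⟨Sum.inl j, congrArg Sum.inl hj⟩
    · obtain ⟨j, hj⟩ := hf'.mono a b hab ⟨i, rfl⟩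
      exact ⟨Sum.inr j, congrArg Sum.inr hj⟩
  · rintro (i | i)
    · obtain ⟨a, j, rfl⟩ := hf.cover i
      exact ⟨a, Sum.inl j, rfl⟩
    · obtain ⟨a, j, rfl⟩ := hf'.cover i
      exact ⟨a, Sum.inr j, rfl⟩

theorem prodMap (hf : IsDirectedCover f) (K : Type*) :
    IsDirectedCover fun a => Prod.map (id : K → K) (f a) := by
  refine ⟨fun a b hab => ?_, ?_⟩
  · rintro _ ⟨⟨k, i⟩, rfl⟩
    obtain ⟨j, hj⟩ := hf.mono a b hab ⟨i, rfl⟩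
    exact ⟨(k, j), congrArg (Prod.mk k) hj⟩
  · rintro ⟨k, i⟩
    obtain ⟨a, j, rfl⟩ := hf.cover i
    exact ⟨a, (k, j), rfl⟩

theorem inclusion {S : I → Set ι} {T : Set ι} (hS : Monotone S) (hST : ∀ a, S a ⊆ T)
    (hT : T ⊆ ⋃ a, S a) : IsDirectedCover fun a => Set.inclusion (hST a) := by
  refine ⟨fun a b hab => ?_, fun i => ?_⟩
  · rintro _ ⟨i, rfl⟩
    exact ⟨⟨i, hS hab i.2⟩, rfl⟩
  · obtain ⟨a, ha⟩ := mem_iUnion.1 (hT i.2)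
    exact ⟨a, ⟨i, ha⟩, rfl⟩

theorem exists_formula [Nonempty I] (hf : IsDirectedCover f) (φ : L.Formula ι) :
    ∃ (a : I) (χ : L.Formula (κ a)), ∀ x : ι → C, χ.Realize (x ∘ f a) ↔ φ.Realize x := by
  classical
  obtain ⟨a, -, ha⟩ := hf.exists_finset (BoundedFormula.freeVarFinset φ) (Classical.arbitrary I)
  obtain ⟨χ, hχ⟩ := φ.exists_restrict _ subset_rfl
  choose r hr using ha
  refine ⟨a, χ.relabel fun i => r i.1 i.2, fun x => ?_⟩
  rw [Formula.realize_relabel, ← hχ]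
  exact iff_of_eq (congrArg _ (funext fun i => congrArg x (hr i.1 i.2)))

end IsDirectedCover

/-- The tuples `x` and `y` satisfy the same formulas without parameters. -/
def SameType {ι : Type*} (x y : ι → C) : Prop :=
  ∀ φ : L.Formula ι, φ.Realize x ↔ φ.Realize y

/-- The tuples `x` and `y` satisfy the same formulas with parameters from `A`. -/
def SameTypeOver {ι : Type*} (A : Set C) (x y : ι → C) : Prop :=
  SameType L (Sum.elim x ((↑) : A → C)) (Sum.elim y ((↑) : A → C))

variable {L}

namespace SameType

variable {ι κ : Type*} {x y z : ι → C}

theorem refl (x : ι → C) : SameType L x x := fun _ => Iff.rfl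

theorem symm (h : SameType L x y) : SameType L y x := fun φ => (h φ).symm

theorem trans (h : SameType L x y) (h' : SameType L y z) : SameType L x z := fun φ =>
  (h φ).trans (h' φ)

theorem comp (h : SameType L x y) (f : κ → ι) : SameType L (x ∘ f) (y ∘ f) := fun φ => by
  simpa only [Formula.realize_relabel] using h (φ.relabel f)

theorem of_forall_exists (h : SameType L x y) {x' y' : κ → C}
    (H : ∀ j, ∃ i, x i = x' j ∧ y i = y' j) : SameType L x' y' := by
  choose f hf using H
  have hx : x ∘ f = x' := funext fun j => (hf j).1
  have hy : y ∘ f = y' := funext fun j => (hf j).2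
  exact hx ▸ hy ▸ h.comp f

theorem of_imp (h : ∀ φ : L.Formula ι, φ.Realize x → φ.Realize y) : SameType L x y := fun φ =>
  ⟨h φ, fun hy => by
    by_contra hx
    exact (Formula.realize_not.1 (h φ.not (Formula.realize_not.2 hx))) hy⟩

theorem of_finset (h : ∀ S : Finset ι, SameType L (fun i : S => x i) (fun i : S => y i)) :
    SameType L x y := by
  classical
  intro φ
  obtain ⟨χ, hχ⟩ := φ.exists_restrict _ subset_rfl
  rw [← hχ, ← hχ]
  exact h _ χ

/-- Finitely many coordinates matter to a formula, and they all lie in the image of one stage, which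
may be taken beyond any given `a₀`. -/
theorem of_directed {I : Type*} [LinearOrder I] [Nonempty I] {κ : I → Type*} {f : ∀ a, κ a → ι}
    (hf : IsDirectedCover f) (a₀ : I) (h : ∀ a, a₀ ≤ a → SameType L (x ∘ f a) (y ∘ f a)) :
    SameType L x y := by
  refine of_finset fun S => ?_
  obtain ⟨b, hb₀, hb⟩ := hf.exists_finset S a₀
  refine (h b hb₀).of_forall_exists fun j => ?_
  obtain ⟨i, hi⟩ := hb j j.2
  exact ⟨i, by simp [hi], by simp [hi]⟩

end SameType

namespace SameTypeOver

variable {ι κ : Type*} {A B : Set C} {x y z : ι → C}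

theorem mono (h : SameTypeOver L B x y) (hAB : A ⊆ B) : SameTypeOver L A x y :=
  SameType.of_forall_exists h (by
    rintro (j | j)
    · exact ⟨Sum.inl j, rfl, rfl⟩
    · exact ⟨Sum.inr ⟨j, hAB j.2⟩, rfl, rfl⟩)

theorem of_forall_exists (h : SameTypeOver L A x y) {x' y' : κ → C}
    (H : ∀ j, (∃ i, x i = x' j ∧ y i = y' j) ∨ x' j ∈ A ∧ x' j = y' j) :
    SameTypeOver L A x' y' :=
  SameType.of_forall_exists h (by
    rintro (j | j)
    · rcases H j with ⟨i, hi⟩ | ⟨hA, hxy⟩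
      · exact ⟨Sum.inl i, hi⟩
      · exact ⟨Sum.inr ⟨_, hA⟩, rfl, hxy⟩
    · exact ⟨Sum.inr j, rfl, rfl⟩)

end SameTypeOver

variable (L)

theorem mem_tp_relabel_iff {ι : Type x} (c : ι → C) (A : Set C) (ψ : L.Formula (ι ⊕ A)) :
    ψ.relabel (Sum.map id Subtype.val) ∈ tp L c A ↔ ψ.Realize (Sum.elim c (↑)) := by
  refine Iff.trans ⟨fun h => h.2, fun h => ⟨⟨ψ, rfl⟩, h⟩⟩ ?_
  rw [Formula.realize_relabel, Sum.elim_comp_map]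
  rfl

theorem tp_subset_of_sameTypeOver {ι : Type x} {c d : ι → C} {A B : Set C} (hAB : A ⊆ B)
    (h : SameTypeOver L A c d) : tp L c A ⊆ tp L d B := by
  rintro _ ⟨⟨ψ, rfl⟩, hψ⟩
  have h' := (mem_tp_relabel_iff L d A ψ).2
    ((h ψ).1 ((mem_tp_relabel_iff L c A ψ).1 ⟨⟨ψ, rfl⟩, hψ⟩))
  refine ⟨⟨ψ.relabel (Sum.map id (inclusion hAB)), ?_⟩, h'.2⟩
  have hcomp : (Sum.map id Subtype.val : ι ⊕ A → ι ⊕ C) =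
      Sum.map id Subtype.val ∘ Sum.map id (inclusion hAB) := by
    ext i; rcases i with i | i <;> rfl
  rw [hcomp, Formula.relabel_relabel]

theorem sameTypeOver_of_tp_subset {ι : Type x} {c d : ι → C} {A B : Set C}
    (h : tp L c A ⊆ tp L d B) : SameTypeOver L A c d := by
  refine SameType.of_imp fun ψ hψ => ?_
  have h' := (h ((mem_tp_relabel_iff L c A ψ).2 hψ)).2
  exact (mem_tp_relabel_iff L d A ψ).1 ⟨⟨ψ, rfl⟩, h'⟩

theorem tp_eq_iff {ι : Type x} {c d : ι → C} {A : Set C} :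
    tp L c A = tp L d A ↔ SameTypeOver L A c d :=
  ⟨fun h => sameTypeOver_of_tp_subset L h.subset, fun h =>
    (tp_subset_of_sameTypeOver L subset_rfl h).antisymm
      (tp_subset_of_sameTypeOver L subset_rfl h.symm)⟩

theorem relabel_mem_tp {ι κ : Type*} {c : ι → C} {A : Set C} (φ : L.Formula (ι ⊕ κ))
    {b : κ → C} (hb : ∀ k, b k ∈ A) (h : φ.Realize (Sum.elim c b)) :
    φ.relabel (Sum.map id b) ∈ tp L c A := by
  refine ⟨⟨φ.relabel (Sum.map id fun k => ⟨b k, hb k⟩), ?_⟩, ?_⟩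
  · rw [Formula.relabel_relabel, Sum.map_comp_map]
    rfl
  · rwa [Formula.realize_relabel, Sum.elim_comp_map]

end ModelTheory

/-! ### Semantic forms of non-splitting and of entailment between types. -/

namespace ModelTheory

open FirstOrder.Language

variable {L : FirstOrder.Language.{v, w}} {C : Type u} [L.Structure C]

theorem DoesNotSplit.sameType {ι κ : Type*} {c : ι → C} {E B : Set C}
    (h : DoesNotSplit (tp L c E) B) {b b' : κ → C} (hb : ∀ k, b k ∈ E) (hb' : ∀ k, b' k ∈ E)
    (hbb : SameTypeOver L B b b') : SameType L (Sum.elim c b) (Sum.elim c b') := by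
  classical
  refine SameType.of_imp fun φ hφ => ?_
  by_contra hφ'
  obtain ⟨n, g, χ, -, hχ⟩ := φ.exists_finite_right
  refine h n χ (b ∘ g) (b' ∘ g) (relabel_mem_tp L χ (fun k => hb _) ((hχ c b).2 hφ))
    (relabel_mem_tp L χ.not (fun k => hb' _) ?_) ?_
  · exact fun h => hφ' ((hχ c b').1 h)
  · exact (tp_eq_iff L).2 (hbb.of_forall_exists fun j => Or.inl ⟨g j, rfl, rfl⟩)

/-- In the definition of splitting the tuples `b`, `b'` may have entries outside `E` at variables
that do not occur in the formula. Passing to the variables that do occur puts the parameters in `E`;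
this is what the computation of free variables under relabelling is for. -/
theorem doesNotSplit_of_sameType {ι : Type*} {c : ι → C} {E B : Set C}
    (h : ∀ (n : ℕ) (b b' : Fin n → C), (∀ k, b k ∈ E) → (∀ k, b' k ∈ E) →
      SameTypeOver L B b b' → SameType L (Sum.elim c b) (Sum.elim c b')) :
    DoesNotSplit (tp L c E) B := by
  classical
  intro n φ b b' hb hb' htp
  obtain ⟨m, g, χ, hg, hχ⟩ := φ.exists_finite_right
  have mem : ∀ (θ : L.Formula (ι ⊕ Fin n)) (b : Fin n → C),
      θ.relabel (Sum.map id b) ∈ tp L c E →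
      ∀ k, Sum.inr k ∈ BoundedFormula.freeVarFinset θ → b k ∈ E := by
    rintro θ b ⟨⟨ψ, hψ⟩, -⟩ k hk
    have h1 : Sum.inr (b k) ∈ BoundedFormula.freeVarFinset (θ.relabel (Sum.map id b)) := by
      rw [Formula.freeVarFinset_relabel]
      exact Finset.mem_image.2 ⟨_, hk, rfl⟩
    rw [hψ, Formula.freeVarFinset_relabel] at h1
    obtain ⟨i | i, -, hi⟩ := Finset.mem_image.1 h1
    · simp at hi
    · rw [Sum.map_inr, Sum.inr.injEq] at hi
      exact hi ▸ i.2
  have hg' : ∀ k, Sum.inr (g k) ∈ BoundedFormula.freeVarFinset φ.not := fun k => by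
    simpa [Formula.not, BoundedFormula.not] using hg k
  have key := h m (b ∘ g) (b' ∘ g) (fun k => mem φ b hb _ (hg k))
    (fun k => mem φ.not b' hb' _ (hg' k))
    (((tp_eq_iff L).1 htp).of_forall_exists fun j => Or.inl ⟨g j, rfl, rfl⟩) χ
  have h1 := hb.2
  have h2 := hb'.2
  rw [Formula.realize_relabel, Sum.elim_comp_map] at h1 h2
  exact h2 ((hχ c b').1 (key.1 ((hχ c b).2 h1)))

theorem entails_tp_iff {ι : Type*} {d : ι → C} {E₁ E₂ : Set C} :
    Entails (tp L d E₁) (tp L d E₂) ↔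
      ∀ φ : L.Formula (ι ⊕ E₂), φ.Realize (Sum.elim d (↑)) →
        ∃ ψ : L.Formula (ι ⊕ E₁), ψ.Realize (Sum.elim d (↑)) ∧
          ∀ z : ι → C, ψ.Realize (Sum.elim z (↑)) → φ.Realize (Sum.elim z (↑)) := by
  constructor
  · intro h φ hφ
    obtain ⟨p₀, hp₀, hφ'⟩ := h _ ((mem_tp_relabel_iff L d E₂ φ).2 hφ)
    choose ψ hψ using fun q : p₀ => (hp₀ q.2).1
    have hreal : ∀ (q : p₀) (z : ι → C),
        (ψ q).Realize (Sum.elim z (↑)) ↔ q.1.Realize (Sum.elim z id) := by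
      intro q z
      rw [hψ q, Formula.realize_relabel, Sum.elim_comp_map]
      rfl
    -- A finite part of a type over `E₁` can be replaced by its conjunction.
    refine ⟨Formula.iInf ψ, ?_, fun z hz => ?_⟩
    · rw [Formula.realize_iInf]
      exact fun q => (hreal q d).2 (hp₀ q.2).2
    · rw [Formula.realize_iInf] at hz
      have := hφ' z fun q hq => (hreal ⟨q, hq⟩ z).1 (hz ⟨q, hq⟩)
      rwa [Formula.realize_relabel, Sum.elim_comp_map] at this
  · rintro h _ ⟨⟨φ, rfl⟩, hφ⟩
    rw [Formula.realize_relabel, Sum.elim_comp_map] at hφ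
    obtain ⟨ψ, hψ, hψφ⟩ := h φ hφ
    refine ⟨{ψ.relabel (Sum.map id Subtype.val)}, ?_, fun z hz => ?_⟩
    · simpa using (mem_tp_relabel_iff L d E₁ ψ).2 hψ
    · have := hz _ (Finset.mem_singleton_self _)
      rw [Formula.realize_relabel, Sum.elim_comp_map] at this ⊢
      exact hψφ z this

/-- If the type of `d` over `E₁` implies the type of `d` over `E₂ ⊇ range v`, then in order to see
that `(d, v)` and `(d', v')` have the same type it suffices to compare `v` with `v'`, and the parts
of `(d, v)` and `(d', v')` concerning `E₁`. -/
theorem Entails.sameType {ι κ μ : Type*} {d d' : ι → C} {E₁ E₂ : Set C}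
    (h : Entails (tp L d E₁) (tp L d E₂)) {v v' : κ → C} (g : μ → κ) (hv : ∀ k, v k ∈ E₂)
    (hE : ∀ a ∈ E₁, ∃ m, v (g m) = a) (hvv : SameType L v v')
    (hd : SameType L (Sum.elim d (v ∘ g)) (Sum.elim d' (v' ∘ g))) :
    SameType L (Sum.elim d v) (Sum.elim d' v') := by
  rcases isEmpty_or_nonempty C with hC | hC
  · rw [show Sum.elim d v = Sum.elim d' v' from funext fun i => (hC.false (Sum.elim d v i)).elim]
    exact SameType.refl _
  refine SameType.of_imp fun φ hφ => ?_
  obtain ⟨ψ, hψ, hψφ⟩ := entails_tp_iff.1 h (φ.relabel (Sum.map id fun k => ⟨v k, hv k⟩)) (by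
    rw [Formula.realize_relabel, Sum.elim_comp_map]
    exact hφ)
  choose e he using hE
  let ψ' : L.Formula (ι ⊕ μ) := ψ.relabel (Sum.map id fun a : E₁ => e a.1 a.2)
  have hψ' : ∀ z : ι → C, ψ'.Realize (Sum.elim z (v ∘ g)) ↔ ψ.Realize (Sum.elim z (↑)) := by
    intro z
    rw [Formula.realize_relabel, Sum.elim_comp_map]
    refine iff_of_eq (congrArg _ (congrArg _ (funext fun a : E₁ => he a.1 a.2)))
  -- `χ(v)` says that some `z` satisfies `ψ` but not `φ` over `v`. It fails at `v` by the
  -- entailment, hence at `v'`, where `d'` would otherwise witness it.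
  obtain ⟨χ, hχ⟩ := (ψ'.relabel (Sum.map id g) ⊓ φ.not).exists_formula_exists
  have h1 : ¬ χ.Realize v := by
    rw [hχ]
    rintro ⟨z, hz⟩
    rw [Formula.realize_inf, Formula.realize_relabel, Sum.elim_comp_map, Formula.realize_not] at hz
    have := hψφ z ((hψ' z).1 hz.1)
    rw [Formula.realize_relabel, Sum.elim_comp_map] at this
    exact hz.2 this
  rw [hvv χ, hχ] at h1
  by_contra hφ'
  refine h1 ⟨d', ?_⟩
  rw [Formula.realize_inf, Formula.realize_relabel, Sum.elim_comp_map, Formula.realize_not]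
  exact ⟨(hd ψ').1 ((hψ' d).2 hψ), hφ'⟩

end ModelTheory

/-! ### Saturation for types in fewer than `κ` variables. -/

namespace ModelTheory

open FirstOrder.Language

section Saturation

variable {L : FirstOrder.Language.{v, w}} {N : Type u} [L.Structure N] {V : Type y} {A : Set N}

/-- Every finite part of `p` is realized by a tuple which agrees with `g` on `S`. -/
def FinitelySatisfiableAt (p : Set (L.Formula (V ⊕ A))) (S : Set V) (g : V → N) : Prop :=
  ∀ p₀ : Finset (L.Formula (V ⊕ A)), ↑p₀ ⊆ p →
    ∃ z : V → N, (∀ i ∈ S, z i = g i) ∧ ∀ φ ∈ p₀, φ.Realize (Sum.elim z (↑))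

namespace FinitelySatisfiableAt

variable {p : Set (L.Formula (V ⊕ A))} {S T : Set V} {g g' : V → N}

theorem mono (h : FinitelySatisfiableAt p T g) (hST : S ⊆ T) (hg : ∀ i ∈ S, g i = g' i) :
    FinitelySatisfiableAt p S g' := fun p₀ hp₀ =>
  (h p₀ hp₀).imp fun _ hz => ⟨fun i hi => (hz.1 i (hST hi)).trans (hg i hi), hz.2⟩

theorem of_finset (h : ∀ F : Finset V, ↑F ⊆ S → FinitelySatisfiableAt p F g) :
    FinitelySatisfiableAt p S g := by
  classical
  intro p₀ hp₀
  -- The coordinates of `S` that do not occur in `p₀` can be reset to `g` without affecting the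
  -- formulas of `p₀`.
  let F : Finset V := (p₀.biUnion fun φ => (BoundedFormula.freeVarFinset φ).toLeft).filter (· ∈ S)
  obtain ⟨z, hz, hz'⟩ := h F (fun i hi => (Finset.mem_filter.1 hi).2) p₀ hp₀
  refine ⟨fun i => if i ∈ S then g i else z i, fun i hi => if_pos hi, fun φ hφ => ?_⟩
  refine (φ.realize_congr ?_).1 (hz' φ hφ)
  rintro (i | i) hi
  · by_cases hiS : i ∈ S
    · simpa [hiS] using hz i (Finset.mem_filter.2
        ⟨Finset.mem_biUnion.2 ⟨φ, hφ, Finset.mem_toLeft.2 hi⟩, hiS⟩)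
    · simp [hiS]
  · rfl

/-- The conditions on the new value `x` form a one-variable type over `A` and the values already
fixed: for each finite part of `p`, the formula saying that `x` and these values extend to a
realization of that part. Finitely many such conditions are handled by the union of their finite
parts. -/
theorem exists_insert [Nonempty N] {κ : Cardinal.{u}} (hN : IsSaturated L N κ) (hκ : ℵ₀ ≤ κ)
    (hA : #A < κ) (hS : Cardinal.lift.{u} #S < Cardinal.lift.{y} κ)
    (h : FinitelySatisfiableAt p S g) {v : V} (hv : v ∉ S) :
    ∃ x, FinitelySatisfiableAt p (insert v S)
      (fun i => open Classical in if i = v then x else g i) := by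
  classical
  let P : Set N := A ∪ g '' S
  have hP : #P < κ := by
    refine (mk_union_le _ _).trans_lt (add_lt_of_lt hκ hA ?_)
    rw [← Cardinal.lift_lt.{u, y}]
    exact mk_image_le_lift.trans_lt hS
  let r : V ⊕ A → V ⊕ (Unit ⊕ P) := Sum.elim
    (fun i => if i = v then Sum.inr (Sum.inl ())
      else if hi : i ∈ S then Sum.inr (Sum.inr ⟨g i, Or.inr ⟨i, hi, rfl⟩⟩) else Sum.inl i)
    (fun a => Sum.inr (Sum.inr ⟨a, Or.inl a.2⟩))
  have hr : ∀ (z : V → N) (x : N),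
      Sum.elim z (Sum.elim (fun _ => x) ((↑) : P → N)) ∘ r =
      Sum.elim (fun i => if i = v then x else if i ∈ S then g i else z i) (↑) := by
    intro z x
    ext i
    rcases i with i | i
    · by_cases hi : i = v
      · simp [r, hi]
      · by_cases hi' : i ∈ S <;> simp [r, hi, hi']
    · rfl
  choose χ hχ using fun p₀ : Finset (L.Formula (V ⊕ A)) =>
    ((Formula.iInf fun φ : p₀ => φ.1).relabel r).exists_formula_exists
  have hχ' : ∀ p₀ x, (χ p₀).Realize (Sum.elim (fun _ => x) ((↑) : P → N)) ↔
      ∃ z : V → N, ∀ φ ∈ p₀, φ.Realize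
        (Sum.elim (fun i => if i = v then x else if i ∈ S then g i else z i) (↑)) := by
    intro p₀ x
    rw [hχ]
    simp only [Formula.realize_relabel, hr, Formula.realize_iInf, Subtype.forall]
  obtain ⟨x, hx⟩ := hN P hP {θ | ∃ p₀ : Finset (L.Formula (V ⊕ A)), ↑p₀ ⊆ p ∧ χ p₀ = θ} (by
    intro q₀ hq₀
    choose! s hs using fun (θ : L.Formula (Unit ⊕ P)) (hθ : θ ∈ q₀) => hq₀ hθ
    obtain ⟨z, hz, hz'⟩ := h (q₀.biUnion s) (by
      intro φ hφ
      obtain ⟨θ, hθ, hφ⟩ := Finset.mem_biUnion.1 hφ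
      exact (hs θ hθ).1 hφ)
    refine ⟨z v, fun θ hθ => ?_⟩
    rw [← (hs θ hθ).2, hχ']
    refine ⟨z, fun φ hφ => ?_⟩
    convert hz' φ (Finset.mem_biUnion.2 ⟨θ, hθ, hφ⟩) using 3 with i
    split_ifs with h1 h2
    · rw [h1]
    · exact (hz i h2).symm
    · rfl)
  refine ⟨x, fun p₀ hp₀ => ?_⟩
  obtain ⟨z, hz⟩ := (hχ' p₀ x).1 (hx _ ⟨p₀, hp₀, rfl⟩)
  refine ⟨_, ?_, hz⟩
  rintro i (rfl | hi)
  · simp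
  · simp [hi]

end FinitelySatisfiableAt

theorem IsSaturated.exists_realize [Nonempty N] {κ : Cardinal.{u}} (hN : IsSaturated L N κ)
    (hκ : ℵ₀ ≤ κ) (hA : #A < κ) (hV : Cardinal.lift.{u} #V < Cardinal.lift.{y} κ)
    (p : Set (L.Formula (V ⊕ A)))
    (hp : ∀ p₀ : Finset (L.Formula (V ⊕ A)), ↑p₀ ⊆ p →
      ∃ z : V → N, ∀ φ ∈ p₀, φ.Realize (Sum.elim z (↑))) :
    ∃ z : V → N, ∀ φ ∈ p, φ.Realize (Sum.elim z (↑)) := by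
  classical
  let _ : LinearOrder V := linearOrderOfSTO WellOrderingRel
  have hwf : WellFounded ((· < ·) : V → V → Prop) := WellOrderingRel.isWellOrder.wf
  -- The values are chosen by recursion on a well-order of `V`; the value at `v` keeps `p` finitely
  -- satisfiable given all values up to `v`, whenever that is possible.
  let step : ∀ v : V, (∀ w, w < v → N) → N := fun v f => Classical.epsilon fun x =>
    FinitelySatisfiableAt p (Iic v) (fun w => if h : w < v then f w h else x)
  let g : V → N := hwf.fix step
  have hg : ∀ v, g v = Classical.epsilon fun x =>
      FinitelySatisfiableAt p (Iic v) (fun w => if w < v then g w else x) := fun v =>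
    hwf.fix_eq step v
  -- Limit stages: a finite subset of `S` lies below its maximum, which belongs to `S`.
  have hlim : ∀ S : Set V, (∀ v ∈ S, FinitelySatisfiableAt p (Iic v) g) →
      FinitelySatisfiableAt p S g := by
    intro S hS
    refine FinitelySatisfiableAt.of_finset fun F hF => ?_
    rcases F.eq_empty_or_nonempty with rfl | hne
    · exact fun p₀ hp₀ => (hp p₀ hp₀).imp fun z hz => ⟨by simp, hz⟩
    · exact (hS _ (hF (F.max'_mem hne))).mono (fun i hi => F.le_max' i hi) fun _ _ => rfl
  have hIic : ∀ v, FinitelySatisfiableAt p (Iic v) g := by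
    intro v
    induction v using hwf.induction with
    | _ v ih =>
      obtain ⟨x, hx⟩ := (hlim (Iio v) ih).exists_insert hN hκ hA
        ((Cardinal.lift_le.2 (mk_set_le _)).trans_lt hV) (v := v) (lt_irrefl v)
      have hx' : FinitelySatisfiableAt p (Iic v) (fun w => if w < v then g w else x) := by
        refine hx.mono (fun i hi => (lt_or_eq_of_le (mem_Iic.1 hi)).symm) fun i hi => ?_
        rcases lt_or_eq_of_le (mem_Iic.1 hi) with hi | rfl
        · simp [hi, hi.ne]
        · simp
      have := Classical.epsilon_spec (p := fun x =>
        FinitelySatisfiableAt p (Iic v) (fun w => if w < v then g w else x)) ⟨x, hx'⟩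
      rw [← hg] at this
      refine this.mono subset_rfl fun i hi => ?_
      rcases lt_or_eq_of_le (mem_Iic.1 hi) with hi | rfl
      · simp [hi]
      · simp
  have huniv : FinitelySatisfiableAt p univ g := hlim univ fun v _ => hIic v
  refine ⟨g, fun φ hφ => ?_⟩
  obtain ⟨z, hz, hz'⟩ := huniv {φ} (by simpa using hφ)
  rw [← funext fun i => hz i (mem_univ i)]
  exact hz' φ (Finset.mem_singleton_self _)

end Saturation

end ModelTheory

/-! ### Spreading equality of types along a decomposition. -/

namespace ModelTheory

open FirstOrder.Language

variable {L : FirstOrder.Language.{v, w}} {C : Type u} [L.Structure C]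

theorem SameTypeOver.of_directed {ι I : Type*} [LinearOrder I] [Nonempty I] {κ : I → Type*}
    {f : ∀ a, κ a → ι} (hf : IsDirectedCover f) {S : I → Set C} (hS : Monotone S) {x y : ι → C}
    (a₀ : I) (h : ∀ a, a₀ ≤ a → SameTypeOver L (S a) (x ∘ f a) (y ∘ f a)) :
    SameTypeOver L (⋃ a, S a) x y := by
  refine SameType.of_directed
    (hf.sumMap (IsDirectedCover.inclusion hS (subset_iUnion S) subset_rfl)) a₀
    fun a ha => SameType.of_forall_exists (h a ha) ?_
  rintro (i | i)
  · exact ⟨Sum.inl i, rfl, rfl⟩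
  · exact ⟨Sum.inr i, rfl, rfl⟩

theorem SameTypeOver.iUnion {ι I : Type*} [LinearOrder I] [Nonempty I] {S : I → Set C}
    (hS : Monotone S) {x y : ι → C} (h : ∀ a, SameTypeOver L (S a) x y) :
    SameTypeOver L (⋃ a, S a) x y :=
  SameTypeOver.of_directed IsDirectedCover.const hS (Classical.arbitrary I) fun a _ => h a

theorem Indiscernible.of_directed {ι I : Type*} [LinearOrder I] [Nonempty I] {κ : I → Type*}
    {f : ∀ a, κ a → ι} (hf : IsDirectedCover f) {J : Type*} [LinearOrder J] {x : J → ι → C}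
    {A : Set C} (h : ∀ a, Indiscernible L (fun t => x t ∘ f a) A) : Indiscernible L x A := by
  intro n s t hs ht
  rw [tp_eq_iff, ← iUnion_const (ι := I) A]
  exact SameTypeOver.of_directed (hf.prodMap (Fin n)) monotone_const (Classical.arbitrary I)
    (x := fun k : Fin n × ι => x (s k.1) k.2) (y := fun k : Fin n × ι => x (t k.1) k.2)
    fun a _ => (tp_eq_iff L).1 (h a n s t hs ht)

/-- Non-splitting is applied to the long tuples `(m, S)` and `(m', S)`, which have the same type
over `B` because `B ⊆ S`. -/
theorem DoesNotSplit.sameTypeOver_union {ι κ : Type*} {c : ι → C} {E B S : Set C}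
    (h : DoesNotSplit (tp L c E) B) (hBS : B ⊆ S) (hSE : S ⊆ E) {m m' : κ → C}
    (hm : ∀ k, m k ∈ E) (hm' : ∀ k, m' k ∈ E) (hmm : SameTypeOver L S m m') :
    SameTypeOver L (S ∪ range c) m m' := by
  have := h.sameType (b := Sum.elim m ((↑) : S → C)) (b' := Sum.elim m' ((↑) : S → C))
    (by rintro (k | k); exacts [hm k, hSE k.2]) (by rintro (k | k); exacts [hm' k, hSE k.2])
    (SameType.of_forall_exists hmm (by
      rintro ((k | k) | k)
      · exact ⟨Sum.inl k, rfl, rfl⟩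
      · exact ⟨Sum.inr k, rfl, rfl⟩
      · exact ⟨Sum.inr ⟨k, hBS k.2⟩, rfl, rfl⟩))
  refine this.of_forall_exists ?_
  rintro (k | ⟨_, hk | ⟨i, rfl⟩⟩)
  · exact ⟨Sum.inr (Sum.inl k), rfl, rfl⟩
  · exact ⟨Sum.inr (Sum.inr ⟨_, hk⟩), rfl, rfl⟩
  · exact ⟨Sum.inl i, rfl, rfl⟩

theorem Entails.sameTypeOver_union {ι κ : Type*} {d : ι → C} {E₁ E₂ S : Set C}
    (h : Entails (tp L d E₁) (tp L d E₂)) (hES : E₁ ⊆ S) (hSE : S ⊆ E₂) {m m' : κ → C}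
    (hm : ∀ k, m k ∈ E₂) (hmm : SameTypeOver L S m m') :
    SameTypeOver L (S ∪ range d) m m' := by
  have := h.sameType (d' := d) (v := Sum.elim m ((↑) : S → C)) (v' := Sum.elim m' ((↑) : S → C))
    (fun a : E₁ => Sum.inr ⟨a.1, hES a.2⟩) (by rintro (k | k); exacts [hm k, hSE k.2])
    (fun a ha => ⟨⟨a, ha⟩, rfl⟩) hmm (SameType.refl _)
  refine this.of_forall_exists ?_
  rintro (k | ⟨_, hk | ⟨i, rfl⟩⟩)
  · exact ⟨Sum.inr (Sum.inl k), rfl, rfl⟩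
  · exact ⟨Sum.inr (Sum.inr ⟨_, hk⟩), rfl, rfl⟩
  · exact ⟨Sum.inl i, rfl, rfl⟩

theorem Indiscernible.mono {J ι : Type*} [LinearOrder J] {x : J → ι → C} {A A' : Set C}
    (h : Indiscernible L x A') (hA : A ⊆ A') : Indiscernible L x A := fun n s t hs ht =>
  (tp_eq_iff L).2 (((tp_eq_iff L).1 (h n s t hs ht)).mono hA)

/-- The sequence `⟨c'⌢d'⟩⌢⟨c_t⌢d_t : t ∈ J⟩`. -/
def consSeq {J I K : Type*} (c' : I → C) (d' : K → C) (c : J → I → C) (d : J → K → C)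
    (t : WithBot J) : I ⊕ K → C :=
  t.recBotCoe (Sum.elim c' d') (fun s => Sum.elim (c s) (d s))

/-- The pair of the first two members of an indiscernible sequence has the same type as the pair
of the following two. -/
theorem Indiscernible.sameTypeOver_pair {I K : Type*} {c' : I → C} {d' : K → C}
    {c : ℕ → I → C} {d : ℕ → K → C} {A : Set C} (h : Indiscernible L (consSeq c' d' c d) A) :
    SameTypeOver L A (Sum.elim (Sum.elim c' d') (Sum.elim (c 0) (d 0)))
      (Sum.elim (Sum.elim (c 0) (d 0)) (Sum.elim (c 1) (d 1))) := by
  have := (tp_eq_iff L).1 (h 2 ![⊥, ((0 : ℕ) : WithBot ℕ)]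
    ![((0 : ℕ) : WithBot ℕ), ((1 : ℕ) : WithBot ℕ)]
    (by rw [Fin.strictMono_iff_lt_succ]; intro i; fin_cases i; exact WithBot.bot_lt_coe 0)
    (by
      rw [Fin.strictMono_iff_lt_succ]; intro i; fin_cases i
      exact WithBot.coe_lt_coe.2 Nat.zero_lt_one))
  refine this.of_forall_exists ?_
  rintro (j | j)
  · exact Or.inl ⟨(0, j), rfl, rfl⟩
  · exact Or.inl ⟨(1, j), rfl, rfl⟩

namespace IsStrictDecomposition

variable {κ θ : Cardinal.{u}} {M B : Set C} {α β : Ordinal.{u}} {c : ℕ → Set.Iio α → C}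
  {d : ℕ → Set.Iio β → C}

theorem doesNotSplit_nat (h : IsStrictDecomposition L κ θ M B c d) (n : ℕ) :
    DoesNotSplit (tp L (c n) (M ∪ ⋃ j < n, (range (c j) ∪ range (d j)))) B := by
  have := h.doesNotSplit n (fun i => i.1) (fun _ _ h => h) (Fin.last n)
  have hset : (⋃ j < n, (range (c j) ∪ range (d j))) =
      ⋃ j < Fin.last n, (range (c j.1) ∪ range (d j.1)) := by
    ext a
    simp only [mem_iUnion]
    constructor
    · rintro ⟨j, hj, ha⟩
      exact ⟨⟨j, by omega⟩, hj, ha⟩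
    · rintro ⟨j, hj, ha⟩
      exact ⟨j, hj, ha⟩
  rwa [hset]

/-- If `⟨cf⌢df⟩⌢⟨c_n⌢d_n : n < ω⟩` is indiscernible over `A₁ ⊇ A ⊇ B`, then the type
over `A + cf + df` of a tuple of `M` that is realized in `A₁` determines its type over `A` and the
whole sequence. -/
theorem sameTypeOver_of_reflects (h : IsStrictDecomposition L κ θ M B c d) {A A₁ : Set C}
    (hBA : B ⊆ A) (hAA : A ⊆ A₁) (hAM : A₁ ⊆ M) {cf : Set.Iio α → C} {df : Set.Iio β → C}
    (hcf : range cf ⊆ M) (hdf : range df ⊆ M) (hf : Indiscernible L (consSeq cf df c d) A₁)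
    {ι : Type*} {m m' : ι → C} (hm : ∀ i, m i ∈ A₁) (hm' : ∀ i, m' i ∈ M)
    (hmm : SameTypeOver L (A ∪ range cf ∪ range df) m m') :
    SameTypeOver L (A ∪ ⋃ n, (range (c n) ∪ range (d n))) m m' := by
  let S : ℕ → Set C := fun k => A ∪ range cf ∪ range df ∪ ⋃ j < k, (range (c j) ∪ range (d j))
  have hbase : A ∪ range cf ∪ range df ⊆ M :=
    union_subset (union_subset (hAA.trans hAM) hcf) hdf
  have hSmono : Monotone S := fun a b hab => union_subset_union_right _
    (biUnion_subset_biUnion_left fun j hj => lt_of_lt_of_le hj hab)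
  have hBS : ∀ k, B ⊆ S k := fun k a ha => Or.inl (Or.inl (Or.inl (hBA ha)))
  have hSsucc : ∀ k, S (k + 1) = S k ∪ range (c k) ∪ range (d k) := by
    intro k
    simp only [S, Nat.lt_succ_iff_lt_or_eq, iUnion_or, iUnion_union_distrib, iUnion_iUnion_eq_left]
    ext a
    simp only [mem_union]
    tauto
  -- Adjoining `c k` uses only non-splitting over `B`.
  have hfst : ∀ k, SameTypeOver L (S k) m m' → SameTypeOver L (S k ∪ range (c k)) m m' :=
    fun k hk => (h.doesNotSplit_nat k).sameTypeOver_union (hBS k)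
      (union_subset_union_left _ hbase) (fun i => Or.inl (hAM (hm i))) (fun i => Or.inl (hm' i)) hk
  have key : ∀ k, SameTypeOver L (S k) m m' := by
    intro k
    induction k with
    | zero => exact hmm.mono (by simp [S])
    | succ k ih =>
      have ih' := hfst k ih
      rw [hSsucc]
      -- No member precedes `d 0`, so `cf⌢df` stands in for one: the entailment for `d 1` over `c 1
      -- + d 0` is shifted one place to the left. The shift is legitimate for `m`, which lies in
      -- `A₁`, but not for `m'`, which is only in `M`. So `m` is carried across to `v` in `h1`, and
      -- replaced by `m'` in `h2`, where `d 0` does not yet appear.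
      rcases k with _ | k
      · have hpair := hf.sameTypeOver_pair
        let v : (Set.Iio α ⊕ Set.Iio β) ⊕ (Set.Iio α ⊕ ι ⊕ A) → C :=
          Sum.elim (Sum.elim (c 1) (d 0)) (Sum.elim (c 0) (Sum.elim m (↑)))
        let v₁ : (Set.Iio α ⊕ Set.Iio β) ⊕ (Set.Iio α ⊕ ι ⊕ A) → C :=
          Sum.elim (Sum.elim (c 0) df) (Sum.elim cf (Sum.elim m (↑)))
        let v₂ : (Set.Iio α ⊕ Set.Iio β) ⊕ (Set.Iio α ⊕ ι ⊕ A) → C :=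
          Sum.elim (Sum.elim (c 0) df) (Sum.elim cf (Sum.elim m' (↑)))
        have h1 : SameType L (Sum.elim (d 0) v₁) (Sum.elim (d 1) v) := by
          refine SameType.of_forall_exists hpair ?_
          rintro (j | (j | j) | j | j | j)
          · exact ⟨Sum.inl (Sum.inr (Sum.inr j)), rfl, rfl⟩
          · exact ⟨Sum.inl (Sum.inr (Sum.inl j)), rfl, rfl⟩
          · exact ⟨Sum.inl (Sum.inl (Sum.inr j)), rfl, rfl⟩
          · exact ⟨Sum.inl (Sum.inl (Sum.inl j)), rfl, rfl⟩
          · exact ⟨Sum.inr ⟨m j, hm j⟩, rfl, rfl⟩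
          · exact ⟨Sum.inr ⟨j, hAA j.2⟩, rfl, rfl⟩
        have h2 : SameType L v₁ v₂ := by
          refine SameType.of_forall_exists ih' ?_
          rintro ((j | j) | j | j | j)
          · exact ⟨Sum.inr ⟨_, Or.inr ⟨j, rfl⟩⟩, rfl, rfl⟩
          · exact ⟨Sum.inr ⟨_, Or.inl (Or.inl (Or.inr ⟨j, rfl⟩))⟩, rfl, rfl⟩
          · exact ⟨Sum.inr ⟨_, Or.inl (Or.inl (Or.inl (Or.inr ⟨j, rfl⟩)))⟩, rfl, rfl⟩
          · exact ⟨Sum.inl j, rfl, rfl⟩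
          · exact ⟨Sum.inr ⟨_, Or.inl (Or.inl (Or.inl (Or.inl j.2)))⟩, rfl, rfl⟩
        -- The type of `d 1` over `c 1 + d 0` determines its type over all of `v`; hence equality of
        -- the small parts, given by `h1`, yields equality with `v₂` in place of `v`.
        have h3 := (h.entails 0 1 Nat.zero_lt_one).sameType (v := v) (v' := v₂) (d' := d 0)
          (Sum.inl : Set.Iio α ⊕ Set.Iio β → _)
          (by
            rintro ((j | j) | j | j | j)
            · exact Or.inl (Or.inr (mem_iUnion.2 ⟨1, j, rfl⟩))
            · exact Or.inl (Or.inl (mem_iUnion₂.2 ⟨0, le_rfl, Or.inr ⟨j, rfl⟩⟩))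
            · exact Or.inl (Or.inr (mem_iUnion.2 ⟨0, j, rfl⟩))
            · exact Or.inr (hAM (hm j))
            · exact Or.inr (hAM (hAA j.2)))
          (by
            rintro a (⟨j, rfl⟩ | ⟨j, rfl⟩)
            · exact ⟨Sum.inl j, rfl⟩
            · exact ⟨Sum.inr j, rfl⟩)
          ((h1.symm.comp Sum.inr).trans h2)
          (h1.symm.of_forall_exists (by
            rintro (j | j | j)
            · exact ⟨Sum.inl j, rfl, rfl⟩
            · exact ⟨Sum.inr (Sum.inl (Sum.inl j)), rfl, rfl⟩
            · exact ⟨Sum.inr (Sum.inl (Sum.inr j)), rfl, rfl⟩))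
        refine (h1.trans h3).of_forall_exists ?_
        rintro (j | ⟨_, (((((ha | ⟨j, rfl⟩) | ⟨j, rfl⟩) | ha) | ⟨j, rfl⟩) | ⟨j, rfl⟩)⟩)
        · exact ⟨Sum.inr (Sum.inr (Sum.inr (Sum.inl j))), rfl, rfl⟩
        · exact ⟨Sum.inr (Sum.inr (Sum.inr (Sum.inr ⟨_, ha⟩))), rfl, rfl⟩
        · exact ⟨Sum.inr (Sum.inr (Sum.inl j)), rfl, rfl⟩
        · exact ⟨Sum.inr (Sum.inl (Sum.inr j)), rfl, rfl⟩
        · simp at ha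
        · exact ⟨Sum.inr (Sum.inl (Sum.inl j)), rfl, rfl⟩
        · exact ⟨Sum.inl j, rfl, rfl⟩
      -- Here `d k` is a genuine predecessor, and clause (e) applies directly, since `S (k + 1)`
      -- together with `c (k + 1)` lies in its larger parameter set.
      · refine (h.entails k (k + 1) k.lt_succ_self).sameTypeOver_union ?_ ?_
          (fun i => Or.inr (hAM (hm i))) ih'
        · rintro a (ha | ha)
          · exact Or.inr ha
          · exact Or.inl (Or.inr (mem_iUnion₂.2 ⟨k, k.lt_succ_self, Or.inr ha⟩))
        · rintro a ((ha | ha) | ha)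
          · exact Or.inr (hbase ha)
          · obtain ⟨j, hj, ha⟩ := mem_iUnion₂.1 ha
            exact Or.inl (Or.inl (mem_iUnion₂.2 ⟨j, Nat.lt_succ_iff.1 hj, ha⟩))
          · exact Or.inl (Or.inr (mem_iUnion.2 ⟨k + 1, ha⟩))
  refine (SameTypeOver.iUnion hSmono key).mono ?_
  rintro a (ha | ha)
  · exact mem_iUnion.2 ⟨0, Or.inl (Or.inl (Or.inl ha))⟩
  · obtain ⟨n, ha⟩ := mem_iUnion.1 ha
    exact mem_iUnion.2 ⟨n + 1, Or.inr (mem_iUnion₂.2 ⟨n, n.lt_succ_self, ha⟩)⟩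

end IsStrictDecomposition

end ModelTheory

/-! ### Replacing the prolonging tuple, gluing types by saturation, unions of sequences. -/

namespace ModelTheory

open FirstOrder.Language

variable {L : FirstOrder.Language.{v, w}} {C : Type u} [L.Structure C]

/-- Relative to the first member, all other members of a finite subsequence are parameters, so they
may be absorbed into the base of the type. -/
theorem Indiscernible.consSeq_congr {J I K : Type*} [LinearOrder J] {c₁ c₂ : I → C} {d₁ d₂ : K → C}
    {c : J → I → C} {d : J → K → C} {A : Set C} (h : Indiscernible L (consSeq c₁ d₁ c d) A)
    (hst : SameTypeOver L (A ∪ ⋃ n, (range (c n) ∪ range (d n))) (Sum.elim c₁ d₁)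
      (Sum.elim c₂ d₂)) : Indiscernible L (consSeq c₂ d₂ c d) A := by
  have key : ∀ (n : ℕ) (s : Fin n → WithBot J),
      SameTypeOver L A (fun k : Fin n × (I ⊕ K) => consSeq c₁ d₁ c d (s k.1) k.2)
        (fun k : Fin n × (I ⊕ K) => consSeq c₂ d₂ c d (s k.1) k.2) := by
    intro n s
    refine SameType.of_forall_exists hst ?_
    rintro (⟨i, k⟩ | k)
    · cases hi : s i using WithBot.recBotCoe with
      | bot => exact ⟨Sum.inl k, by simp [hi, consSeq], by simp [hi, consSeq]⟩
      | coe j =>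
        rcases k with k | k
        · exact ⟨Sum.inr ⟨c j k, Or.inr (mem_iUnion.2 ⟨j, Or.inl ⟨k, rfl⟩⟩)⟩,
            by simp [hi, consSeq], by simp [hi, consSeq]⟩
        · exact ⟨Sum.inr ⟨d j k, Or.inr (mem_iUnion.2 ⟨j, Or.inr ⟨k, rfl⟩⟩)⟩,
            by simp [hi, consSeq], by simp [hi, consSeq]⟩
    · exact ⟨Sum.inr ⟨k, Or.inl k.2⟩, rfl, rfl⟩
  intro n s t hs ht
  exact (tp_eq_iff L).2
    (((key n s).symm.trans ((tp_eq_iff L).1 (h n s t hs ht))).trans (key n t))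

/-- Finitely many conditions mention finitely many stages, and a bound `b` of these supplies a
common solution by `he b`. Elementarity of `N` lets formulas be evaluated in `C` or in `N` alike. -/
theorem IsSaturated.exists_sameTypeOver {N : L.ElementarySubstructure C} {κ : Cardinal.{u}}
    (hN : IsSaturated L N κ) (hκ : ℵ₀ ≤ κ) {V I : Type*} [LinearOrder I] [Nonempty I]
    (hV : Cardinal.lift.{u} #V < Cardinal.lift κ) {μ : I → Type*} (f : ∀ a, μ a → V)
    {P : I → Set C} (hPN : (⋃ a, P a) ⊆ N) (hP : #(⋃ a, P a) < κ) (e : ∀ a, μ a → C)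
    (he : ∀ b, ∃ z : V → C, (∀ v, z v ∈ N) ∧ ∀ a ≤ b, SameTypeOver L (P a) (z ∘ f a) (e a)) :
    ∃ z : V → C, (∀ v, z v ∈ N) ∧ ∀ a, SameTypeOver L (P a) (z ∘ f a) (e a) := by
  classical
  rcases isEmpty_or_nonempty N with hE | hne
  · obtain ⟨z, hzN, -⟩ := he (Classical.arbitrary I)
    refine ⟨z, hzN, fun a => ?_⟩
    rw [show z ∘ f a = e a from funext fun k => (hE.false ⟨_, hzN (f a k)⟩).elim]
    exact SameType.refl _
  let Q : Set N := (↑) ⁻¹' (⋃ a, P a)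
  have hQ : #Q < κ :=
    (mk_preimage_of_injective _ _ Subtype.val_injective).trans_lt hP
  let r : ∀ a, μ a ⊕ P a → V ⊕ Q := fun a => Sum.map (f a) fun c =>
    ⟨⟨c, hPN (mem_iUnion.2 ⟨a, c.2⟩)⟩, mem_iUnion.2 ⟨a, c.2⟩⟩
  have hr : ∀ a (χ : L.Formula (μ a ⊕ P a)) (z : V → N),
      (χ.relabel (r a)).Realize (Sum.elim z ((↑) : Q → N)) ↔
        χ.Realize (Sum.elim (fun k => (z (f a k) : C)) (↑)) := by
    intro a χ z
    rw [← N.subtype.map_formula, Formula.realize_relabel]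
    refine iff_of_eq (congrArg _ (funext ?_))
    rintro (i | i) <;> rfl
  obtain ⟨z, hz⟩ := hN.exists_realize hκ hQ hV
    {φ | ∃ a, ∃ χ : L.Formula (μ a ⊕ P a), χ.Realize (Sum.elim (e a) (↑)) ∧ χ.relabel (r a) = φ}
    (by
      intro p₀ hp₀
      choose! s hs using fun (φ : L.Formula (V ⊕ Q)) (hφ : φ ∈ p₀) => hp₀ hφ
      obtain ⟨b, hb⟩ := (p₀.image s).exists_le
      obtain ⟨z, hzN, hz⟩ := he b
      refine ⟨fun v => ⟨z v, hzN v⟩, fun φ hφ => ?_⟩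
      obtain ⟨χ, hχ, hχφ⟩ := hs φ hφ
      rw [← hχφ, hr]
      exact (hz (s φ) (hb _ (Finset.mem_image_of_mem s hφ)) χ).2 hχ)
  refine ⟨fun v => z v, fun v => (z v).2, fun a => SameType.symm (SameType.of_imp fun χ hχ => ?_)⟩
  exact (hr a χ z).1 (hz _ ⟨a, χ, hχ, rfl⟩)

theorem monotone_range_of_isInitialSegment {X : Type x} {I : Type y} [LinearOrder I]
    {len : I → Ordinal.{u}} {s : ∀ a, Set.Iio (len a) → X}
    (hs : ∀ a b, a < b → IsInitialSegment (s a) (s b)) : Monotone fun a => range (s a) := by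
  refine monotone_iff_forall_lt.2 fun a b hab => ?_
  rintro _ ⟨i, rfl⟩
  exact ⟨_, (hs a b hab).2 i⟩

section SeqUnion

variable {X : Type x} {I : Type y} [Small.{u} I] {len : I → Ordinal.{u}}

/-- The inclusion of the index set of a member of a family of sequences into that of the union. -/
def seqIncl (len : I → Ordinal.{u}) (a : I) (i : Set.Iio (len a)) : Set.Iio (⨆ a, len a) :=
  ⟨i.1, lt_of_lt_of_le i.2 (Ordinal.le_iSup len a)⟩

theorem seqIncl_injective (len : I → Ordinal.{u}) (a : I) : Function.Injective (seqIncl len a) :=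
  by
  intro i j h
  exact Subtype.ext (congrArg (fun k => k.1) h)

variable [LinearOrder I]

theorem isDirectedCover_seqIncl (h : Monotone len) : IsDirectedCover (seqIncl len) := by
  refine ⟨fun a b hab => ?_, fun i => ?_⟩
  · rintro _ ⟨i, rfl⟩
    exact ⟨⟨i.1, lt_of_lt_of_le i.2 (h hab)⟩, rfl⟩
  · obtain ⟨a, ha⟩ := exists_lt_of_mem_Iio_iSup i
    exact ⟨a, ⟨i.1, ha⟩, rfl⟩

theorem seqUnion_comp_seqIncl {s : ∀ a, Set.Iio (len a) → X}
    (hs : ∀ a b, a < b → IsInitialSegment (s a) (s b)) (a : I) :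
    seqUnion s ∘ seqIncl len a = s a :=
  funext (isInitialSegment_seqUnion s hs a).2

theorem range_seqUnion {s : ∀ a, Set.Iio (len a) → X}
    (hs : ∀ a b, a < b → IsInitialSegment (s a) (s b)) :
    range (seqUnion s) = ⋃ a, range (s a) := by
  ext c
  simp only [mem_iUnion]
  constructor
  · rintro ⟨i, rfl⟩
    obtain ⟨a, ha⟩ := exists_lt_of_mem_Iio_iSup i
    exact ⟨a, ⟨i.1, ha⟩, (congrFun (seqUnion_comp_seqIncl hs a) ⟨i.1, ha⟩).symm⟩
  · rintro ⟨a, i, rfl⟩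
    exact ⟨seqIncl len a i, congrFun (seqUnion_comp_seqIncl hs a) i⟩

end SeqUnion

end ModelTheory

/-! ### Cardinality bounds, and clauses (c), (d), (e) for the union. -/

namespace ModelTheory

open FirstOrder.Language

theorem mk_iUnion_lt_of_lt_cof_ord {X : Type u} {I : Type y} [Small.{u} I] {κ : Cardinal.{u}}
    (hκ : ℵ₀ ≤ κ) (hI : #(Shrink.{u} I) < κ.ord.cof) {S : I → Set X} (hS : ∀ a, #(S a) < κ) :
    #(⋃ a, S a) < κ := by
  rw [← (equivShrink I).symm.surjective.iUnion_comp]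
  refine (mk_iUnion_le _).trans_lt (mul_lt_of_lt hκ (hI.trans_le ?_)
    (Cardinal.iSup_lt_of_lt_cof_ord hI fun a => hS _))
  exact Ordinal.cof_ord_le κ

theorem mk_range_lt_of_lt_ord {X : Type u} {α : Ordinal.{u}} {κ : Cardinal.{u}} (hα : α < κ.ord)
    (s : Set.Iio α → X) : #(range s) < κ := by
  rw [← Cardinal.lift_lt.{u, u + 1}]
  refine mk_range_le_lift.trans_lt ?_
  rw [Cardinal.mk_Iio_ordinal, Cardinal.lift_lift, Cardinal.lift_lt]
  exact lt_ord.1 hα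

theorem iSup_lt_ord_of_isRegular {I : Type y} [Small.{u} I] {θ : Cardinal.{u}} (hθ : θ.IsRegular)
    (hI : #(Shrink.{u} I) < θ) {len : I → Ordinal.{u}} (h : ∀ a, len a < θ.ord) :
    ⨆ a, len a < θ.ord := by
  rw [← (equivShrink I).symm.surjective.iSup_comp]
  exact Ordinal.iSup_lt_of_lt_cof (by rwa [hθ.cof_ord]) fun a => h _

section Chain

variable {L : FirstOrder.Language.{v, w}} {C : Type u} [L.Structure C]
variable {I : Type y} [LinearOrder I] {κ θ : Cardinal.{u}} {M : Set C}
  {B : I → Set C} {lc ld : I → Ordinal.{u}} {c : ∀ a, ℕ → Set.Iio (lc a) → C}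
  {d : ∀ a, ℕ → Set.Iio (ld a) → C}

theorem monotone_union_iUnion_range
    (hc : ∀ a b, a < b → ∀ n, IsInitialSegment (c a n) (c b n))
    (hd : ∀ a b, a < b → ∀ n, IsInitialSegment (d a n) (d b n)) {J : Type*} (t : J → ℕ)
    (p : J → Prop) :
    Monotone fun a => M ∪ ⋃ (j) (_ : p j), (range (c a (t j)) ∪ range (d a (t j))) :=
  fun _ _ hab => union_subset_union_right _ (iUnion₂_mono fun j _ => union_subset_union
    (monotone_range_of_isInitialSegment (fun a b h => hc a b h (t j)) hab)
    (monotone_range_of_isInitialSegment (fun a b h => hd a b h (t j)) hab))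

variable [Nonempty I] [Small.{u} I]

theorem union_iUnion_range_seqUnion_subset
    (hc : ∀ a b, a < b → ∀ n, IsInitialSegment (c a n) (c b n))
    (hd : ∀ a b, a < b → ∀ n, IsInitialSegment (d a n) (d b n)) {J : Type*} (t : J → ℕ)
    (p : J → Prop) :
    (M ∪ ⋃ (j) (_ : p j), (range (seqUnion fun a => c a (t j)) ∪
        range (seqUnion fun a => d a (t j)))) ⊆
      ⋃ a, (M ∪ ⋃ (j) (_ : p j), (range (c a (t j)) ∪ range (d a (t j)))) := by
  simp only [range_seqUnion fun a b h => hc a b h _, range_seqUnion fun a b h => hd a b h _]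
  rintro x (hx | hx)
  · exact mem_iUnion.2 ⟨Classical.arbitrary I, Or.inl hx⟩
  · obtain ⟨j, hj, hx | hx⟩ := mem_iUnion₂.1 hx
    · obtain ⟨a, hx⟩ := mem_iUnion.1 hx
      exact mem_iUnion.2 ⟨a, Or.inr (mem_iUnion₂.2 ⟨j, hj, Or.inl hx⟩)⟩
    · obtain ⟨a, hx⟩ := mem_iUnion.1 hx
      exact mem_iUnion.2 ⟨a, Or.inr (mem_iUnion₂.2 ⟨j, hj, Or.inr hx⟩)⟩

theorem sameTypeOver_seqUnion_of_increasing
    (hdec : ∀ a, IsStrictDecomposition L κ θ M (B a) (c a) (d a))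
    (hc : ∀ a b, a < b → ∀ n, IsInitialSegment (c a n) (c b n))
    (hd : ∀ a b, a < b → ∀ n, IsInitialSegment (d a n) (d b n))
    (k : ℕ) (t : Fin (k + 1) → ℕ) (ht : StrictMono t) (m n : Fin (k + 1)) (hmn : m ≤ n) :
    SameTypeOver L (M ∪ ⋃ j < m, (range (seqUnion fun a => c a (t j)) ∪
        range (seqUnion fun a => d a (t j))))
      (seqUnion fun a => c a (t m)) (seqUnion fun a => c a (t n)) := by
  have hlc : Monotone lc := monotone_iff_forall_lt.2 fun a b hab => (hc a b hab 0).1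
  refine (SameTypeOver.of_directed (isDirectedCover_seqIncl hlc)
    (monotone_union_iUnion_range (M := M) hc hd t (· < m)) (Classical.arbitrary I) fun a _ => ?_).mono ?_
  · rw [seqUnion_comp_seqIncl fun a b h => hc a b h (t m),
      seqUnion_comp_seqIncl fun a b h => hc a b h (t n)]
    exact sameTypeOver_of_tp_subset L ((hdec a).increasing k t ht m n hmn)
  · exact union_iUnion_range_seqUnion_subset hc hd t (· < m)

theorem doesNotSplit_seqUnion
    (hdec : ∀ a, IsStrictDecomposition L κ θ M (B a) (c a) (d a))
    (hc : ∀ a b, a < b → ∀ n, IsInitialSegment (c a n) (c b n))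
    (hd : ∀ a b, a < b → ∀ n, IsInitialSegment (d a n) (d b n))
    (k : ℕ) (t : Fin (k + 1) → ℕ) (ht : StrictMono t) (n : Fin (k + 1)) :
    DoesNotSplit (tp L (seqUnion fun a => c a (t n)) (M ∪ ⋃ j < n,
      (range (seqUnion fun a => c a (t j)) ∪ range (seqUnion fun a => d a (t j))))) (⋃ a, B a) := by
  have hlc : Monotone lc := monotone_iff_forall_lt.2 fun a b hab => (hc a b hab 0).1
  have hS := monotone_union_iUnion_range (M := M) hc hd t (· < n)
  have hST := union_iUnion_range_seqUnion_subset (M := M) hc hd t (· < n)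
  refine doesNotSplit_of_sameType fun m b b' hb hb' hbb => ?_
  choose s hs using fun i => mem_iUnion.1 (hST (hb i))
  choose s' hs' using fun i => mem_iUnion.1 (hST (hb' i))
  -- From stage `a₀` on, all entries of the two finite tuples are legitimate parameters.
  obtain ⟨a₀, ha₀⟩ := (Finset.univ.image s ∪ Finset.univ.image s').exists_le
  refine SameType.of_directed ((isDirectedCover_seqIncl hlc).sumMap
    (IsDirectedCover.const (ι := Fin m))) a₀ fun a ha => ?_
  have := ((hdec a).doesNotSplit k t ht n).sameType (b := b) (b' := b')
    (fun i => hS ((ha₀ (s i) (by simp)).trans ha) (hs i))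
    (fun i => hS ((ha₀ (s' i) (by simp)).trans ha) (hs' i))
    (hbb.mono (subset_iUnion B a))
  rwa [Sum.elim_comp_map, Sum.elim_comp_map, Function.comp_id, Function.comp_id,
    seqUnion_comp_seqIncl fun a b h => hc a b h (t n)]

theorem indiscernible_seqUnion
    (hdec : ∀ a, IsStrictDecomposition L κ θ M (B a) (c a) (d a))
    (hc : ∀ a b, a < b → ∀ n, IsInitialSegment (c a n) (c b n))
    (hd : ∀ a b, a < b → ∀ n, IsInitialSegment (d a n) (d b n)) :
    Indiscernible L (fun n => Sum.elim (seqUnion fun a => c a n) (seqUnion fun a => d a n)) M := by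
  have hlc : Monotone lc := monotone_iff_forall_lt.2 fun a b hab => (hc a b hab 0).1
  have hld : Monotone ld := monotone_iff_forall_lt.2 fun a b hab => (hd a b hab 0).1
  refine Indiscernible.of_directed
    ((isDirectedCover_seqIncl hlc).sumMap (isDirectedCover_seqIncl hld)) fun a => ?_
  simp only [Sum.elim_comp_map, seqUnion_comp_seqIncl fun a b h => hc a b h _,
    seqUnion_comp_seqIncl fun a b h => hd a b h _]
  exact (hdec a).indiscernible

theorem entails_seqUnion
    (hdec : ∀ a, IsStrictDecomposition L κ θ M (B a) (c a) (d a))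
    (hc : ∀ a b, a < b → ∀ n, IsInitialSegment (c a n) (c b n))
    (hd : ∀ a b, a < b → ∀ n, IsInitialSegment (d a n) (d b n)) {s t : ℕ} (hst : s < t) :
    Entails (tp L (seqUnion fun a => d a t)
        (range (seqUnion fun a => c a t) ∪ range (seqUnion fun a => d a s)))
      (tp L (seqUnion fun a => d a t)
        ((⋃ r ≤ s, (range (seqUnion fun a => c a r) ∪ range (seqUnion fun a => d a r))) ∪
          (⋃ r, range (seqUnion fun a => c a r)) ∪ M)) := by
  have hld : Monotone ld := monotone_iff_forall_lt.2 fun a b hab => (hd a b hab 0).1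
  have hc' := fun n => monotone_range_of_isInitialSegment (fun a b h => hc a b h n)
  have hd' := fun n => monotone_range_of_isInitialSegment (fun a b h => hd a b h n)
  let S : I → Set C := fun a =>
    (⋃ r ≤ s, (range (c a r) ∪ range (d a r))) ∪ (⋃ r, range (c a r)) ∪ M
  have hS : Monotone S := fun a b hab => union_subset_union_left _ (union_subset_union
    (iUnion₂_mono fun j _ => union_subset_union (hc' j hab) (hd' j hab))
    (iUnion_mono fun j => hc' j hab))
  simp only [range_seqUnion fun a b h => hc a b h _, range_seqUnion fun a b h => hd a b h _]
  rw [entails_tp_iff]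
  intro φ hφ
  have hcover := (isDirectedCover_seqIncl hld).sumMap (IsDirectedCover.inclusion
    (T := (⋃ r ≤ s, ((⋃ a, range (c a r)) ∪ ⋃ a, range (d a r))) ∪ (⋃ r, ⋃ a, range (c a r)) ∪ M)
    hS
    (fun a => union_subset_union_left _ (union_subset_union
      (iUnion₂_mono fun j _ => union_subset_union (subset_iUnion (fun a => range (c a j)) a)
        (subset_iUnion (fun a => range (d a j)) a))
      (iUnion_mono fun j => subset_iUnion (fun a => range (c a j)) a)))
    (by
      rintro x ((hx | hx) | hx)
      · obtain ⟨j, hj, hx | hx⟩ := mem_iUnion₂.1 hx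
        · obtain ⟨a, hx⟩ := mem_iUnion.1 hx
          exact mem_iUnion.2 ⟨a, Or.inl (Or.inl (mem_iUnion₂.2 ⟨j, hj, Or.inl hx⟩))⟩
        · obtain ⟨a, hx⟩ := mem_iUnion.1 hx
          exact mem_iUnion.2 ⟨a, Or.inl (Or.inl (mem_iUnion₂.2 ⟨j, hj, Or.inr hx⟩))⟩
      · obtain ⟨j, hx⟩ := mem_iUnion.1 hx
        obtain ⟨a, hx⟩ := mem_iUnion.1 hx
        exact mem_iUnion.2 ⟨a, Or.inl (Or.inr (mem_iUnion.2 ⟨j, hx⟩))⟩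
      · exact mem_iUnion.2 ⟨Classical.arbitrary I, Or.inr hx⟩))
  -- `φ` lives at a single stage `a`, in its variables as well as its parameters; the entailing
  -- formula of that stage is then read over the union.
  obtain ⟨a, χ, hχ⟩ := hcover.exists_formula (C := C) L φ
  have hχ' : ∀ z : Set.Iio (⨆ a, ld a) → C,
      χ.Realize (Sum.elim (z ∘ seqIncl ld a) (↑)) ↔ φ.Realize (Sum.elim z (↑)) := by
    intro z
    rw [← hχ, Sum.elim_comp_map]
    rfl
  have hdt := seqUnion_comp_seqIncl (fun a b h => hd a b h t) a
  obtain ⟨ψ, hψ, hψχ⟩ := entails_tp_iff.1 ((hdec a).entails s t hst) χ (by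
    rw [← hdt]
    exact (hχ' _).2 hφ)
  have hψ' : ∀ z : Set.Iio (⨆ a, ld a) → C,
      (ψ.relabel (Sum.map (seqIncl ld a) (inclusion (union_subset_union
        (subset_iUnion (fun a => range (c a t)) a)
        (subset_iUnion (fun a => range (d a s)) a))))).Realize (Sum.elim z (↑)) ↔
      ψ.Realize (Sum.elim (z ∘ seqIncl ld a) (↑)) := by
    intro z
    rw [Formula.realize_relabel, Sum.elim_comp_map]
    rfl
  refine ⟨_, (hψ' _).2 (by rwa [hdt]), fun z hz => ?_⟩
  exact (hχ' z).1 (hψχ _ ((hψ' z).1 hz))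

end Chain

end ModelTheory

/-! ### Clause (f): a single prolongation for the union. -/

namespace ModelTheory

open FirstOrder.Language

section Reflects

variable {L : FirstOrder.Language.{v, w}} {C : Type u} [L.Structure C]
variable {I : Type y} [LinearOrder I] [Nonempty I] [Small.{u} I] {κ θ : Cardinal.{u}} {M : Set C}
  {B : I → Set C} {lc ld : I → Ordinal.{u}} {c : ∀ a, ℕ → Set.Iio (lc a) → C}
  {d : ∀ a, ℕ → Set.Iio (ld a) → C}

/-- If `e` and `f` prolong indiscernible sequences over `A` and over `A₁ ⊇ A + e` respectively, and
the first of these sequences consists of extensions of the members of the second, then `e⌢f` has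
over `A` the same type as two consecutive members of the sequence. -/
theorem sameTypeOver_of_prolongations {I₁ K₁ I₂ K₂ : Type*} {A A₁ : Set C} (hAA : A ⊆ A₁)
    {ec : I₁ → C} {ed : K₁ → C} {c₁ : ℕ → I₁ → C} {d₁ : ℕ → K₁ → C}
    (he : Indiscernible L (consSeq ec ed c₁ d₁) A) (hec : range ec ⊆ A₁) (hed : range ed ⊆ A₁)
    {fc : I₂ → C} {fd : K₂ → C} {c₂ : ℕ → I₂ → C} {d₂ : ℕ → K₂ → C}
    (hf : Indiscernible L (consSeq fc fd c₂ d₂) A₁) {x : I₂ ⊕ K₂ → C}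
    (hx : ∀ k, ∃ k', Sum.elim ec ed k' = x k ∧
      ∀ n, Sum.elim (c₁ n) (d₁ n) k' = Sum.elim (c₂ n) (d₂ n) k) :
    SameTypeOver L A (Sum.elim x (Sum.elim fc fd))
      (Sum.elim (Sum.elim (c₂ 0) (d₂ 0)) (Sum.elim (c₂ 1) (d₂ 1))) := by
  choose r hr hr' using hx
  have hxA : ∀ k, x k ∈ A₁ := by
    intro k
    rw [← hr k]
    rcases r k with i | i
    · exact hec ⟨i, rfl⟩
    · exact hed ⟨i, rfl⟩
  -- Because `x` lies in `A₁`, it can be held fixed while the first member `fc⌢fd` is moved to the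
  -- next one.
  have h1 : SameTypeOver L A (Sum.elim x (Sum.elim fc fd))
      (Sum.elim x (Sum.elim (c₂ 0) (d₂ 0))) := by
    refine (hf.sameTypeOver_pair.of_forall_exists ?_).mono hAA
    rintro (k | k)
    · exact Or.inr ⟨hxA k, rfl⟩
    · exact Or.inl ⟨Sum.inl k, rfl, rfl⟩
  refine SameType.trans h1 (he.sameTypeOver_pair.of_forall_exists ?_)
  rintro (k | k)
  · exact Or.inl ⟨Sum.inl (r k), hr k, hr' k 0⟩
  · exact Or.inl ⟨Sum.inr (r k), hr' k 0, hr' k 1⟩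

theorem exists_prolongation_seqUnion (hκ : ℵ₀ ≤ κ) (hI : #(Shrink.{u} I) < κ.ord.cof)
    (hdec : ∀ a, IsStrictDecomposition L κ θ M (B a) (c a) (d a))
    (hc : ∀ a b, a < b → ∀ n, IsInitialSegment (c a n) (c b n))
    (hd : ∀ a b, a < b → ∀ n, IsInitialSegment (d a n) (d b n))
    (hlcκ : ⨆ a, lc a < κ.ord) (hldκ : ⨆ a, ld a < κ.ord) {A : Set C} (hAM : A ⊆ M)
    (hA : #A < κ) :
    ∃ (c' : Set.Iio (⨆ a, lc a) → C) (d' : Set.Iio (⨆ a, ld a) → C), range c' ⊆ M ∧ range d' ⊆ M ∧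
      Indiscernible L (consSeq c' d' (fun n => seqUnion fun a => c a n)
        (fun n => seqUnion fun a => d a n)) A := by
  have hlc : Monotone lc := monotone_iff_forall_lt.2 fun a b hab => (hc a b hab 0).1
  have hld : Monotone ld := monotone_iff_forall_lt.2 fun a b hab => (hd a b hab 0).1
  have hκ0 : κ ≠ 0 := (aleph0_pos.trans_le hκ).ne'
  have hsmall : ∀ {cs : ∀ a, Set.Iio (lc a) → C} {ds : ∀ a, Set.Iio (ld a) → C},
      #(⋃ a, (range (cs a) ∪ range (ds a))) < κ := fun {cs ds} =>
    mk_iUnion_lt_of_lt_cof_ord hκ hI fun a => (mk_union_le _ _).trans_lt (add_lt_of_lt hκ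
      (mk_range_lt_of_lt_ord ((Ordinal.le_iSup lc a).trans_lt hlcκ) _)
      (mk_range_lt_of_lt_ord ((Ordinal.le_iSup ld a).trans_lt hldκ) _))
  let A₀ : Set C := A ∪ ⋃ a, B a
  have hA₀M : A₀ ⊆ M := union_subset hAM (iUnion_subset fun a => (hdec a).base_subset)
  have hA₀ : #A₀ < κ := (mk_union_le _ _).trans_lt (add_lt_of_lt hκ hA
    (mk_iUnion_lt_of_lt_cof_ord hκ hI fun a => (hdec a).card_base_lt hκ0))
  have hBA₀ : ∀ a, B a ⊆ A₀ := fun a => (subset_iUnion B a).trans subset_union_right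
  choose ec ed hec hed he using fun a => (hdec a).reflects A₀ hA₀M hA₀
  -- All the `e_a` enter the base, not just the one at the same stage: coherence compares `e_b` with
  -- `f_a` for `a ≤ b`.
  let A₁ : Set C := A₀ ∪ ⋃ a, (range (ec a) ∪ range (ed a))
  have hA₁M : A₁ ⊆ M :=
    union_subset hA₀M (iUnion_subset fun a => union_subset (hec a) (hed a))
  have hA₁ : #A₁ < κ := (mk_union_le _ _).trans_lt (add_lt_of_lt hκ hA₀ hsmall)
  have hecA₁ : ∀ a, range (ec a) ⊆ A₁ := fun a x hx => Or.inr (mem_iUnion.2 ⟨a, Or.inl hx⟩)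
  have hedA₁ : ∀ a, range (ed a) ⊆ A₁ := fun a x hx => Or.inr (mem_iUnion.2 ⟨a, Or.inr hx⟩)
  choose fc fd hfc hfd hf using fun a => (hdec a).reflects A₁ hA₁M hA₁
  obtain ⟨N, rfl, hN⟩ := (hdec (Classical.arbitrary I)).saturated hκ0
  let P : I → Set C := fun a => A₀ ∪ range (fc a) ∪ range (fd a)
  have hPN : (⋃ a, P a) ⊆ N :=
    iUnion_subset fun a => union_subset (union_subset hA₀M (hfc a)) (hfd a)
  have hP : #(⋃ a, P a) < κ := by
    refine (mk_le_mk_of_subset (t := A₀ ∪ ⋃ a, (range (fc a) ∪ range (fd a))) ?_).trans_lt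
      ((mk_union_le _ _).trans_lt (add_lt_of_lt hκ hA₀ hsmall))
    refine iUnion_subset fun a => ?_
    rintro x ((hx | hx) | hx)
    · exact Or.inl hx
    · exact Or.inr (mem_iUnion.2 ⟨a, Or.inl hx⟩)
    · exact Or.inr (mem_iUnion.2 ⟨a, Or.inr hx⟩)
  have hcover := (isDirectedCover_seqIncl hlc).sumMap (isDirectedCover_seqIncl hld)
  let F : ∀ a, Set.Iio (lc a) ⊕ Set.Iio (ld a) → Set.Iio (⨆ a, lc a) ⊕ Set.Iio (⨆ a, ld a) :=
    fun a => Sum.map (seqIncl lc a) (seqIncl ld a)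
  have hF : ∀ a, Function.Injective (F a) := fun a =>
    Function.Injective.sumMap (seqIncl_injective lc a) (seqIncl_injective ld a)
  have hFS : ∀ a n k, Sum.elim (seqUnion fun a => c a n) (seqUnion fun a => d a n) (F a k) =
      Sum.elim (c a n) (d a n) k := by
    intro a n k
    rw [← seqUnion_comp_seqIncl (fun a b h => hc a b h n) a,
      ← seqUnion_comp_seqIncl (fun a b h => hd a b h n) a, ← Sum.elim_comp_map]
    rfl
  have hEN : ∀ a k, Sum.elim (ec a) (ed a) k ∈ N := by
    rintro a (k | k)
    · exact hec a ⟨k, rfl⟩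
    · exact hed a ⟨k, rfl⟩
  -- Default values in `N` for the coordinates beyond a given stage.
  choose n₀ hn₀ using fun v => show ∃ x, x ∈ N from
    let ⟨a, k, _⟩ := hcover.cover v
    ⟨_, hEN a k⟩
  obtain ⟨g, hgN, hg⟩ := hN.exists_sameTypeOver hκ (V := Set.Iio (⨆ a, lc a) ⊕ Set.Iio (⨆ a, ld a))
    (by
      rw [mk_sum, Cardinal.mk_Iio_ordinal, Cardinal.mk_Iio_ordinal]
      simp only [Cardinal.lift_lift, ← Cardinal.lift_add]
      rw [Cardinal.lift_lt]
      exact add_lt_of_lt hκ (lt_ord.1 hlcκ) (lt_ord.1 hldκ)) F hPN hP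
    (fun a => Sum.elim (ec a) (ed a)) (by
      -- For the stages `a ≤ b` the common solution is `e_b`, padded by default values.
      intro b
      have hz : ∀ k, Function.extend (F b) (Sum.elim (ec b) (ed b)) n₀ (F b k) =
          Sum.elim (ec b) (ed b) k := (hF b).extend_apply _ _
      refine ⟨Function.extend (F b) (Sum.elim (ec b) (ed b)) n₀, fun v => ?_,
        fun a hab => ?_⟩
      · by_cases hv : ∃ k, F b k = v
        · obtain ⟨k, rfl⟩ := hv
          rw [hz]
          exact hEN b k
        · rw [Function.extend_apply' _ _ _ hv]
          exact hn₀ v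
      · have hb := sameTypeOver_of_prolongations (subset_union_left : A₀ ⊆ A₁) (he b) (hecA₁ b)
          (hedA₁ b) (hf a)
          (x := Function.extend (F b) (Sum.elim (ec b) (ed b)) n₀ ∘ F a) (by
            intro k
            obtain ⟨k', hk'⟩ := hcover.mono a b hab ⟨k, rfl⟩
            refine ⟨k', ?_, fun n => ?_⟩
            · rw [Function.comp_apply, ← hz]
              exact congrArg _ hk'
            · rw [← hFS, ← hFS]
              exact congrArg _ hk')
        have ha := sameTypeOver_of_prolongations (subset_union_left : A₀ ⊆ A₁) (he a) (hecA₁ a)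
          (hedA₁ a) (hf a) (x := Sum.elim (ec a) (ed a)) fun k => ⟨k, rfl, fun _ => rfl⟩
        refine SameType.of_forall_exists (hb.trans ha.symm) ?_
        rintro (k | ⟨_, ((hk | ⟨k, rfl⟩) | ⟨k, rfl⟩)⟩)
        · exact ⟨Sum.inl (Sum.inl k), rfl, rfl⟩
        · exact ⟨Sum.inr ⟨_, hk⟩, rfl, rfl⟩
        · exact ⟨Sum.inl (Sum.inr (Sum.inl k)), rfl, rfl⟩
        · exact ⟨Sum.inl (Sum.inr (Sum.inr k)), rfl, rfl⟩)
  refine ⟨g ∘ Sum.inl, g ∘ Sum.inr, ?_, ?_, ?_⟩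
  · rintro _ ⟨i, rfl⟩
    exact hgN _
  · rintro _ ⟨i, rfl⟩
    exact hgN _
  refine Indiscernible.of_directed hcover fun a => ?_
  -- The restriction of `g` agrees with `e_a` over `A₀ + f_a`, hence over `A₀` and the whole `a`-th
  -- sequence; so it may replace `e_a` as prolonging tuple.
  have key := (hdec a).sameTypeOver_of_reflects (hBA₀ a) (subset_union_left : A₀ ⊆ A₁) hA₁M
    (hfc a) (hfd a) (hf a) (m := Sum.elim (ec a) (ed a)) (m' := g ∘ F a)
    (by
      rintro (k | k)
      · exact hecA₁ a ⟨k, rfl⟩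
      · exact hedA₁ a ⟨k, rfl⟩)
    (fun k => hgN _) (hg a).symm
  have hgF : g ∘ F a =
      Sum.elim (g ∘ Sum.inl ∘ seqIncl lc a) (g ∘ Sum.inr ∘ seqIncl ld a) := by
    ext k
    rcases k with k | k <;> rfl
  rw [hgF] at key
  convert ((he a).consSeq_congr key).mono (subset_union_left : A ⊆ A₀) using 2 with t
  cases t using WithBot.recBotCoe with
  | bot => exact (congrArg (· ∘ F a) (Sum.elim_comp_inl_inr g)).trans hgF
  | coe n => exact funext (hFS a n)

end Reflects

end ModelTheory

theorem claim4 {L : FirstOrder.Language.{v, w}} {C : Type u} [L.Structure C]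
    -- the monster model and the smallness of `M`
    (κbar : Cardinal.{u}) (hC : ModelTheory.IsSaturated L C κbar)
    (M : Set C) (hM : #M < κbar)
    (κ θ : Cardinal.{u}) (hθ : θ.IsRegular) (hκ : κ = 0 ∨ θ ≤ κ.ord.cof)
    (δ : Ordinal.{u}) (hδ : Order.IsSuccLimit δ) (hδθ : δ < θ.ord)
    (B : Set.Iio δ → Set C)
    (lc ld : Set.Iio δ → Ordinal.{u})
    (c : ∀ a : Set.Iio δ, ℕ → Set.Iio (lc a) → C)
    (d : ∀ a : Set.Iio δ, ℕ → Set.Iio (ld a) → C)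
    (hdec : ∀ a, ModelTheory.IsStrictDecomposition L κ θ M (B a) (c a) (d a))
    (hc : ∀ a b, a < b → ∀ n, IsInitialSegment (c a n) (c b n))
    (hd : ∀ a b, a < b → ∀ n, IsInitialSegment (d a n) (d b n))
    (hB : ∀ a b, a < b → B a ⊆ B b) :
    ModelTheory.IsStrictDecomposition L κ θ M (⋃ a, B a)
      (fun n => seqUnion (fun a => c a n)) (fun n => seqUnion (fun a => d a n)) := by
  open ModelTheory in
  have : Nonempty (Set.Iio δ) := ⟨⟨0, hδ.bot_lt⟩⟩
  have hIθ : #(Shrink.{u} (Set.Iio δ)) < θ := by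
    rw [← Cardinal.lift_lt.{u, u + 1}, Cardinal.lift_mk_shrink'', Cardinal.mk_Iio_ordinal,
      Cardinal.lift_lt]
    exact lt_ord.1 hδθ
  -- The hypothesis on `cf κ` bounds both the lengths of the tuples (through `θ ≤ κ`) and the number
  -- of stages, without `κ` being regular.
  have hκ' : κ ≠ 0 → ℵ₀ ≤ κ ∧ θ ≤ κ ∧ #(Shrink.{u} (Set.Iio δ)) < κ.ord.cof := fun h0 =>
    have hcof := hκ.resolve_left h0
    have hθκ := hcof.trans (Ordinal.cof_ord_le κ)
    ⟨hθ.aleph0_le.trans hθκ, hθκ, hIθ.trans_le hcof⟩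
  have hlcθ : ⨆ a, lc a < θ.ord := iSup_lt_ord_of_isRegular hθ hIθ fun a => (hdec a).length_fst_lt
  have hldθ : ⨆ a, ld a < θ.ord := iSup_lt_ord_of_isRegular hθ hIθ fun a => (hdec a).length_snd_lt
  exact
  { base_subset := iUnion_subset fun a => (hdec a).base_subset
    card_base_lt := fun h0 => mk_iUnion_lt_of_lt_cof_ord (hκ' h0).1 (hκ' h0).2.2
      fun a => (hdec a).card_base_lt h0
    saturated := (hdec (Classical.arbitrary _)).saturated
    length_fst_lt := hlcθ
    length_snd_lt := hldθ
    increasing := fun k t ht m n hmn => tp_subset_of_sameTypeOver L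
      (union_subset_union_right _ (biUnion_subset_biUnion_left fun j hj => lt_of_lt_of_le hj hmn))
      (sameTypeOver_seqUnion_of_increasing hdec hc hd k t ht m n hmn)
    doesNotSplit := doesNotSplit_seqUnion hdec hc hd
    indiscernible := indiscernible_seqUnion hdec hc hd
    entails := fun s t hst => entails_seqUnion hdec hc hd hst
    reflects := fun A hAM hA => by
      have h0 : κ ≠ 0 := ((zero_le (a := #A)).trans_lt hA).ne'
      have hord := ord_le_ord.2 (hκ' h0).2.1
      exact exists_prolongation_seqUnion (hκ' h0).1 (hκ' h0).2.2 hdec hc hd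
        (hlcθ.trans_le hord) (hldθ.trans_le hord) hAM hA }
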